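/- For a bounded domain $\Omega\subset\mathbb C$ with $C^\infty$-smooth boundary $b\Omega$, let $H^2(b\Omega)$ be the closure in $L^2(b\Omega)$ (with respect to arc length $ds$) of the boundary traces of functions holomorphic on $\Omega$ and $C^\infty$ on $\overline\Omega$, its elements being identified with their holomorphic extensions to $\Omega$. Let $S_\Omega(z,\zeta)$ be its reproducing kernel (the Szegő kernel), $S_\Omega(z)=S_\Omega(z,z)$, and let $$s_\Omega(z)=\sqrt{\frac{\partial^2\log S_\Omega(z)}{\partial z\,\partial\bar z}},\qquad \kappa_{s_\Omega}(z)=-\frac{\Delta\log s_\Omega(z)}{s_\Omega(z)^2}$$ be the Szegő metric and its Gaussian curvature. **Theorem.** For every $\varepsilon>0$ there exist a $C^\infty$-smoothly bounded domain $\Omega_\varepsilon\subset\mathbb C$, whose Szegő kernel exists and whose Szegő metric is a ($C^2$-smooth, positive) conformal metric on $\Omega_\varepsilon$, and a point $z\in\Omega_\varepsilon$ such that $\kappa_{s_{\Omega_\varepsilon}}(z)>4-\varepsilon$. Consequently, if a real constant $C$ satisfies $\kappa_{s_\Omega}(z)\le C$ for all $C^\infty$-smoothly bounded domains $\Omega\subset\mathbb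 C$ and all $z\in\Omega$, then $C\ge 4$; that is, no constant smaller than $4$ is a universal upper bound for the Gaussian curvature of the Szegő metric. -/

import Mathlib

open MeasureTheory Set Filter Topology InnerProductSpace
open scoped ContDiff ComplexConjugate

noncomputable section

namespace Szego

/-- A `C^∞`-smoothly bounded planar domain: a bounded, connected, nonempty open set with a global
smooth defining function whose differential does not vanish on the boundary. -/
structure IsSmoothlyBoundedDomain (Ω : Set ℂ) : Prop where
  isOpen : IsOpen Ω
  isConnected : IsConnected Ω
  isBounded : Bornology.IsBounded Ω
  exists_definingFunction : ∃ ρ : ℂ → ℝ, ContDiff ℝ ∞ ρ ∧ Ω = {z | ρ z < 0} ∧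
    frontier Ω = {z | ρ z = 0} ∧ ∀ z ∈ frontier Ω, fderiv ℝ ρ z ≠ 0

/-- The arc length measure `ds` on the boundary of `Ω`
(one-dimensional Hausdorff measure restricted to the boundary). -/
def arcLength (Ω : Set ℂ) : Measure ℂ :=
  (Measure.hausdorffMeasure 1 : Measure ℂ).restrict (frontier Ω)

/-- The functions that are holomorphic on `Ω` and `C^∞` on the closure of `Ω`. -/
def smoothHolomorphic (Ω : Set ℂ) : Submodule ℂ (ℂ → ℂ) where
  carrier := {f | DifferentiableOn ℂ f Ω ∧ ContDiffOn ℝ ∞ f (closure Ω)}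
  add_mem' hf hg := ⟨hf.1.add hg.1, hf.2.add hg.2⟩
  zero_mem' := ⟨differentiableOn_const 0, contDiffOn_const⟩
  smul_mem' c _ hf := ⟨hf.1.const_smul c, hf.2.const_smul c⟩

/-- `u ∈ L²(bΩ)` is the boundary trace of `f`. -/
def IsTrace (Ω : Set ℂ) (f : ℂ → ℂ) (u : Lp ℂ 2 (arcLength Ω)) : Prop :=
  u =ᵐ[arcLength Ω] f

/-- The subspace of `L²(bΩ)` of boundary traces of functions holomorphic on `Ω` and smooth on
its closure. -/
def smoothTraces (Ω : Set ℂ) : Submodule ℂ (Lp ℂ 2 (arcLength Ω)) where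
  carrier := {u | ∃ f ∈ smoothHolomorphic Ω, IsTrace Ω f u}
  add_mem' := by
    rintro u v ⟨f, hf, hu⟩ ⟨g, hg, hv⟩
    exact ⟨f + g, add_mem hf hg, (Lp.coeFn_add u v).trans (hu.add hv)⟩
  zero_mem' := ⟨0, zero_mem _, Lp.coeFn_zero ℂ 2 (arcLength Ω)⟩
  smul_mem' := by
    rintro c u ⟨f, hf, hu⟩
    exact ⟨c • f, Submodule.smul_mem _ c hf, (Lp.coeFn_smul c u).trans (hu.const_smul c)⟩

/-- The Hardy space `H²(bΩ)`: the closure in `L²(bΩ)` of the smooth traces. -/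
def hardySpace (Ω : Set ℂ) : Submodule ℂ (Lp ℂ 2 (arcLength Ω)) :=
  (smoothTraces Ω).topologicalClosure

/-- `F` is the holomorphic extension to `Ω` of `u ∈ H²(bΩ)`: there are functions `f n`, holomorphic
on `Ω` and smooth on its closure, whose traces tend to `u` in `L²(bΩ)` and which tend to `F` locally
uniformly on `Ω`. -/
def IsHolomorphicExtension (Ω : Set ℂ) (u : Lp ℂ 2 (arcLength Ω)) (F : ℂ → ℂ) : Prop :=
  DifferentiableOn ℂ F Ω ∧
    ∃ (f : ℕ → ℂ → ℂ) (t : ℕ → Lp ℂ 2 (arcLength Ω)),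
      (∀ n, f n ∈ smoothHolomorphic Ω ∧ IsTrace Ω (f n) (t n)) ∧
      Tendsto t atTop (𝓝 u) ∧ TendstoLocallyUniformlyOn f F atTop Ω

/-- `S` is the Szegő kernel (the reproducing kernel of `H²(bΩ)`) on `Ω × Ω`. -/
structure IsSzegoKernel (Ω : Set ℂ) (S : ℂ → ℂ → ℂ) : Prop where
  hermitian : ∀ z ∈ Ω, ∀ ζ ∈ Ω, S z ζ = conj (S ζ z)
  /-- For `z ∈ Ω`, `S(·, z)` is in the Hardy space, with boundary function `k`; and
  `F(z) = ∫ S(z, ζ) u(ζ) ds(ζ)`, where `S(z, ζ) = conj (k ζ)` for `ζ` on the boundary, whenever `F` is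
  the holomorphic extension of `u ∈ H²(bΩ)`. -/
  reproducing : ∀ z ∈ Ω, ∃ k ∈ hardySpace Ω,
    IsHolomorphicExtension Ω k (fun w => S w z) ∧
    ∀ u ∈ hardySpace Ω, ∀ F : ℂ → ℂ, IsHolomorphicExtension Ω u F →
      F z = ∫ ζ, conj (k ζ) * u ζ ∂(arcLength Ω)

/-- The Szegő kernel of `Ω`; it is unique on `Ω × Ω` (see `IsSzegoKernel.eq`). -/
def szegoKernel (Ω : Set ℂ) : ℂ → ℂ → ℂ :=
  Classical.epsilon (IsSzegoKernel Ω)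

theorem isHolomorphicExtension_of_isTrace {Ω : Set ℂ} {f : ℂ → ℂ} {u : Lp ℂ 2 (arcLength Ω)}
    (hf : f ∈ smoothHolomorphic Ω) (hu : IsTrace Ω f u) : IsHolomorphicExtension Ω u f := by
  refine ⟨hf.1, fun _ => f, fun _ => u, fun _ => ⟨hf, hu⟩, tendsto_const_nhds, ?_⟩
  intro V hV x _
  exact ⟨univ, univ_mem, Eventually.of_forall fun _ _ _ => refl_mem_uniformity hV⟩

theorem integral_conj_mul_eq_inner {Ω : Set ℂ} (k u : Lp ℂ 2 (arcLength Ω)) :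
    ∫ ζ, conj (k ζ) * u ζ ∂(arcLength Ω) = inner ℂ k u := by
  rw [L2.inner_def]
  exact integral_congr_ae (Eventually.of_forall fun ζ => by
    simp [mul_comm])

/-- Uniqueness of the Szegő kernel. -/
theorem IsSzegoKernel.eq {Ω : Set ℂ} {S T : ℂ → ℂ → ℂ} (hS : IsSzegoKernel Ω S)
    (hT : IsSzegoKernel Ω T) {z ζ : ℂ} (hz : z ∈ Ω) (hζ : ζ ∈ Ω) : S z ζ = T z ζ := by
  have key : ∀ w ∈ Ω, ∀ k ∈ hardySpace Ω, ∀ l ∈ hardySpace Ω,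
      (∀ u ∈ hardySpace Ω, ∀ F : ℂ → ℂ, IsHolomorphicExtension Ω u F →
        F w = ∫ ζ, conj (k ζ) * u ζ ∂(arcLength Ω)) →
      (∀ u ∈ hardySpace Ω, ∀ F : ℂ → ℂ, IsHolomorphicExtension Ω u F →
        F w = ∫ ζ, conj (l ζ) * u ζ ∂(arcLength Ω)) → k = l := by
    intro w _ k hk l hl h1 h2
    have h0 : ∀ u ∈ smoothTraces Ω, inner ℂ (k - l) u = 0 := by
      rintro u ⟨f, hf, hu⟩
      have hm : u ∈ hardySpace Ω := Submodule.le_topologicalClosure _ ⟨f, hf, hu⟩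
      have e := isHolomorphicExtension_of_isTrace hf hu
      rw [inner_sub_left, ← integral_conj_mul_eq_inner, ← integral_conj_mul_eq_inner,
        ← h1 u hm f e, ← h2 u hm f e, sub_self]
    have hc : IsClosed {u : Lp ℂ 2 (arcLength Ω) | inner ℂ (k - l) u = 0} :=
      isClosed_eq (by fun_prop) continuous_const
    have h3 : k - l ∈ {u : Lp ℂ 2 (arcLength Ω) | inner ℂ (k - l) u = 0} :=
      closure_minimal h0 hc (sub_mem hk hl)
    exact sub_eq_zero.1 (inner_self_eq_zero.1 h3)
  obtain ⟨k, hk, ek, rk⟩ := hS.reproducing ζ hζ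
  obtain ⟨l, hl, el, rl⟩ := hT.reproducing ζ hζ
  obtain rfl := key ζ hζ k hk l hl rk rl
  obtain ⟨m, -, -, rm⟩ := hS.reproducing z hz
  exact (rm k hk _ ek).trans (rm k hk _ el).symm

/-- The Szegő kernel on the diagonal, `S_Ω(z) = S_Ω(z, z)` (a real number by Hermitian symmetry). -/
def szegoDiag (Ω : Set ℂ) (z : ℂ) : ℝ :=
  (szegoKernel Ω z z).re

/-- The Szegő metric `s_Ω(z) = √(∂² log S_Ω(z) / ∂z ∂z̄)`, where `∂²/∂z∂z̄ = (∂²/∂x² + ∂²/∂y²) / 4`. -/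
def szegoMetric (Ω : Set ℂ) (z : ℂ) : ℝ :=
  Real.sqrt (Laplacian.laplacian (fun w => Real.log (szegoDiag Ω w)) z / 4)

/-- `m(z)|dz|` is a `C²`-smooth conformal metric on `Ω`. -/
def IsConformalMetric (Ω : Set ℂ) (m : ℂ → ℝ) : Prop :=
  ContDiffOn ℝ 2 m Ω ∧ ∀ z ∈ Ω, 0 < m z

/-- The Gaussian curvature `-Δ(log m) / m²` of the conformal metric `m(z)|dz|`. -/
def gaussianCurvature (m : ℂ → ℝ) (z : ℂ) : ℝ :=
  -(Laplacian.laplacian (fun w => Real.log (m w)) z) / m z ^ 2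

end Szego

end

open MeasureTheory Set Filter Topology InnerProductSpace
open scoped ContDiff ComplexConjugate

/-! The witnesses are the annuli `r < |z| < 1` with `r = exp (-L)`, at a point of the middle circle
`|z| = √r`, as `L → ∞`.

The monomials `z ^ n` are orthogonal in the Hardy space, with squared norms `c (1 + r ^ (2n+1))`,
where `c` is the length of the unit circle. By the Laurent expansion, the kernel on the diagonal is
`S(z) = ∑ |z| ^ (2n) / (c (1 + r ^ (2n+1)))` (`isSzegoKernel_annulusKernel`,
`hasSum_szegoDiag_annulus`). With `y = log |z| + L/2`, the function `c |z| S(z)` is the moment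
generating function at `y` of the odd integers `2n+1` with weights `1 / (2 cosh ((2n+1)L/2))`
(`hasSum_sechWeight_mul_exp`).

Let `K` be its logarithm. Then `log S = K(y) - log |z| - log c`. The Laplacian of a function of `log
|z|` is its second derivative divided by `|z|²`, so `s² = K''(y) / (4|z|²)`, and the curvature is
`-2 (log K'')'' / K''`. On the middle circle `y = 0`, where odd moments vanish by symmetry; the
curvature there is `6 - 2 m₄ m₀ / m₂²` in terms of the moments `m_j` (`gaussianCurvature_middle`).

As `L → ∞` the weights, rescaled by `2 cosh (L/2)`, concentrate on the odd integers `±1`. Even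
moments then all have the same limit, the moment ratio tends to `1`, and the curvature tends to `6 -
2 = 4`. -/

namespace Szego

/-! ### Arc length on circles -/

/-- The length of the unit circle with respect to the one-dimensional Hausdorff measure. -/
noncomputable def unitCircleLength : ℝ :=
  ((Measure.hausdorffMeasure 1 : Measure ℂ) (Metric.sphere 0 1)).toReal

/-- Only finiteness and positivity of the length matter, not its value: it enters the kernel as a
constant factor, which `∂∂̄ log` kills. -/
theorem hausdorffMeasure_unitCircle_lt_top :
    (Measure.hausdorffMeasure 1 : Measure ℂ) (Metric.sphere 0 1) < ⊤ := by
  have h : Metric.sphere (0 : ℂ) 1 ⊆ circleMap 0 1 '' Icc 0 (2 * Real.pi) := by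
    intro z hz
    have := (image_circleMap_Ioc 0 1).symm.subset (by simpa using hz)
    obtain ⟨t, ht, rfl⟩ := this
    exact ⟨t, Ioc_subset_Icc_self ht, rfl⟩
  refine (measure_mono h).trans_lt (((lipschitzWith_circleMap 0 1).hausdorffMeasure_image_le
    zero_le_one _).trans_lt ?_)
  rw [hausdorffMeasure_real]
  simp [ENNReal.mul_lt_top]

theorem hausdorffMeasure_unitCircle_pos :
    0 < (Measure.hausdorffMeasure 1 : Measure ℂ) (Metric.sphere 0 1) := by
  have h : Icc (-1 : ℝ) 1 ⊆ Complex.re '' Metric.sphere (0 : ℂ) 1 := by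
    rintro x ⟨h1, h2⟩
    refine ⟨⟨x, √(1 - x ^ 2)⟩, ?_, rfl⟩
    have : 0 ≤ 1 - x ^ 2 := by nlinarith
    rw [mem_sphere_zero_iff_norm, ← sq_eq_sq₀ (norm_nonneg _) zero_le_one, Complex.sq_norm,
      Complex.normSq_mk, Real.mul_self_sqrt this]
    ring
  have hl : LipschitzWith 1 Complex.re := by
    refine LipschitzWith.of_dist_le_mul fun x y => ?_
    simpa [dist_eq_norm, Real.norm_eq_abs] using Complex.abs_re_le_norm (x - y)
  have := (measure_mono h).trans (hl.hausdorffMeasure_image_le zero_le_one (Metric.sphere 0 1))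
  rw [hausdorffMeasure_real] at this
  refine lt_of_lt_of_le ?_ (this.trans_eq (by simp))
  simp

theorem unitCircleLength_pos : 0 < unitCircleLength :=
  ENNReal.toReal_pos hausdorffMeasure_unitCircle_pos.ne' hausdorffMeasure_unitCircle_lt_top.ne

open scoped Pointwise in
theorem hausdorffMeasure_sphere {R : ℝ} (hR : 0 < R) :
    (Measure.hausdorffMeasure 1 : Measure ℂ) (Metric.sphere 0 R) =
      ENNReal.ofReal (R * unitCircleLength) := by
  have h : Metric.sphere (0 : ℂ) R = R • Metric.sphere (0 : ℂ) 1 := by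
    rw [smul_sphere' hR.ne']
    simp [abs_of_pos hR]
  rw [h, Measure.hausdorffMeasure_smul₀ zero_le_one hR.ne', ENNReal.ofReal_mul hR.le,
    unitCircleLength, ENNReal.ofReal_toReal hausdorffMeasure_unitCircle_lt_top.ne]
  simp only [NNReal.rpow_one, ENNReal.smul_def, smul_eq_mul]
  rw [← enorm_eq_nnnorm, Real.enorm_eq_ofReal hR.le]

/-- Hausdorff measure is rotation invariant, so the integral is unchanged when `g` is averaged over
all rotations. After Fubini the inner integral is the circle average, the same for every point of
the circle. -/
theorem setIntegral_sphere_of_continuous {R : ℝ} (hR : 0 < R) {g : ℂ → ℂ} (hg : Continuous g) :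
    ∫ z in Metric.sphere 0 R, g z ∂(Measure.hausdorffMeasure 1 : Measure ℂ) =
      (R * unitCircleLength : ℝ) * Real.circleAverage g 0 R := by
  set μ : Measure ℂ := (Measure.hausdorffMeasure 1 : Measure ℂ).restrict (Metric.sphere 0 R)
    with hμ
  have hfin : IsFiniteMeasure μ := ⟨by
    rw [hμ, Measure.restrict_apply_univ, hausdorffMeasure_sphere hR]
    exact ENNReal.ofReal_lt_top⟩
  have hmem : ∀ᵐ z ∂μ, z ∈ Metric.sphere (0 : ℂ) R :=
    ae_restrict_mem Metric.isClosed_sphere.measurableSet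
  have hrot : ∀ θ : ℝ, ∫ z, g (circleMap 0 1 θ * z) ∂μ = ∫ z, g z ∂μ := by
    intro θ
    let e : ℂ ≃ᵢ ℂ := (rotation (Circle.exp θ)).toIsometryEquiv
    have he : ∀ z, e z = circleMap 0 1 θ * z := fun z => by
      simp [e, circleMap]
    have hp := (e.measurePreserving_hausdorffMeasure 1).setIntegral_preimage_emb
      e.toHomeomorph.measurableEmbedding g (Metric.sphere 0 R)
    have hs : e ⁻¹' Metric.sphere 0 R = Metric.sphere 0 R := by
      ext z
      rw [mem_preimage, mem_sphere_zero_iff_norm, mem_sphere_zero_iff_norm, he]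
      simp
    rw [hs] at hp
    simpa only [he] using hp
  have hin : ∀ z ∈ Metric.sphere (0 : ℂ) R,
      ∫ θ in (0 : ℝ)..2 * Real.pi, g (circleMap 0 1 θ * z) =
        (2 * Real.pi : ℝ) * Real.circleAverage g 0 R := by
    intro z hz
    obtain ⟨η, -, rfl⟩ := (image_circleMap_Ioc 0 R).symm.subset (by simpa [abs_of_pos hR] using hz)
    rw [Real.circleAverage_eq_integral_add η, Complex.real_smul, ← mul_assoc, ← Complex.ofReal_mul,
      mul_inv_cancel₀ (by positivity), Complex.ofReal_one, one_mul]
    congr with θ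
    congr 1
    simp [circleMap, add_mul, Complex.exp_add]
    ring
  have hcont : Continuous fun p : ℝ × ℂ => g (circleMap 0 1 p.1 * p.2) := by
    simp only [circleMap]
    fun_prop
  have hvol : IsFiniteMeasure (volume.restrict (uIoc 0 (2 * Real.pi))) := by
    rw [uIoc_of_le (by positivity)]
    infer_instance
  have hint : Integrable (Function.uncurry fun (θ : ℝ) (z : ℂ) => g (circleMap 0 1 θ * z))
      ((volume.restrict (uIoc 0 (2 * Real.pi))).prod μ) := by
    obtain ⟨C, hC⟩ := (isCompact_sphere (0 : ℂ) R).exists_bound_of_continuousOn hg.continuousOn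
    refine Integrable.of_bound hcont.aestronglyMeasurable C ?_
    have : ∀ᵐ p : ℝ × ℂ ∂((volume.restrict (uIoc 0 (2 * Real.pi))).prod μ),
        p.2 ∈ Metric.sphere (0 : ℂ) R := Measure.quasiMeasurePreserving_snd.ae hmem
    filter_upwards [this] with p hp
    exact hC _ (by simpa using hp)
  have hswap := intervalIntegral_integral_swap hint
  simp only [hrot] at hswap
  rw [intervalIntegral.integral_const,
    integral_congr_ae (hmem.mono fun z hz => hin z hz), integral_const] at hswap
  have h2 : μ.real univ = R * unitCircleLength := by
    rw [measureReal_def, hμ, Measure.restrict_apply_univ, hausdorffMeasure_sphere hR,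
      ENNReal.toReal_ofReal (mul_nonneg hR.le unitCircleLength_pos.le)]
  rw [h2, sub_zero, Complex.real_smul, Complex.real_smul] at hswap
  have h3 : ((2 * Real.pi : ℝ) : ℂ) ≠ 0 := by
    exact_mod_cast (by positivity : (2 * Real.pi : ℝ) ≠ 0)
  apply mul_left_cancel₀ h3
  rw [hswap]
  ring

/-- Both sides see only the values on the circle, so Tietze extension reduces this to globally
continuous `g`. -/
theorem setIntegral_sphere {R : ℝ} (hR : 0 < R) {g : ℂ → ℂ}
    (hg : ContinuousOn g (Metric.sphere 0 R)) :
    ∫ z in Metric.sphere 0 R, g z ∂(Measure.hausdorffMeasure 1 : Measure ℂ) =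
      (R * unitCircleLength : ℝ) * Real.circleAverage g 0 R := by
  obtain ⟨G, hG⟩ := ContinuousMap.exists_restrict_eq (Y := ℂ) Metric.isClosed_sphere
    (⟨(Metric.sphere (0 : ℂ) R).domRestrict g, hg.domRestrict⟩ : C(Metric.sphere (0 : ℂ) R, ℂ))
  have hE : EqOn G g (Metric.sphere (0 : ℂ) R) := fun z hz =>
    DFunLike.congr_fun hG ⟨z, hz⟩
  rw [← setIntegral_congr_fun Metric.isClosed_sphere.measurableSet hE,
    setIntegral_sphere_of_continuous hR G.continuous,
    Real.circleAverage_congr_sphere (f₁ := G) (f₂ := g) (by rwa [abs_of_pos hR])]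

/-! ### Cauchy formula and Laurent expansion on the annulus -/

/-- The open annulus with outer radius one and inner radius `r`. -/
def annulus (r : ℝ) : Set ℂ := {z | r < ‖z‖ ∧ ‖z‖ < 1}

/-- The closed annulus with outer radius one and inner radius `r`. -/
def closedAnnulus (r : ℝ) : Set ℂ := {z | r ≤ ‖z‖ ∧ ‖z‖ ≤ 1}

theorem annulus_subset_closedAnnulus (r : ℝ) : annulus r ⊆ closedAnnulus r :=
  fun _ hz => ⟨hz.1.le, hz.2.le⟩

theorem isOpen_annulus (r : ℝ) : IsOpen (annulus r) :=
  (isOpen_lt continuous_const continuous_norm).inter (isOpen_lt continuous_norm continuous_const)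

theorem sphere_one_subset_closedAnnulus {r : ℝ} (hr : r ≤ 1) :
    Metric.sphere (0 : ℂ) 1 ⊆ closedAnnulus r := fun z hz => by
  rw [mem_sphere_zero_iff_norm] at hz
  exact ⟨by rw [hz]; exact hr, hz.le⟩

theorem sphere_subset_closedAnnulus {r : ℝ} (hr : r ≤ 1) :
    Metric.sphere (0 : ℂ) r ⊆ closedAnnulus r := fun z hz => by
  rw [mem_sphere_zero_iff_norm] at hz
  exact ⟨hz.ge, by rw [hz]; exact hr⟩

theorem ne_zero_of_mem_closedAnnulus {r : ℝ} (hr : 0 < r) {z : ℂ} (hz : z ∈ closedAnnulus r) :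
    z ≠ 0 := norm_pos_iff.1 (hr.trans_le hz.1)

/-- The exceptional set `s` leaves room for `dslope f z`, whose differentiability at `z` then need
not be checked. -/
theorem circleAverage_one_eq_circleAverage {r : ℝ} (h0 : 0 < r) (h1 : r ≤ 1) {f : ℂ → ℂ}
    {s : Set ℂ} (hs : s.Countable) (hc : ContinuousOn f (closedAnnulus r))
    (hd : ∀ z ∈ annulus r \ s, DifferentiableAt ℂ f z) :
    Real.circleAverage f 0 1 = Real.circleAverage f 0 r := by
  rw [Real.circleAverage_eq_circleIntegral one_ne_zero,
    Real.circleAverage_eq_circleIntegral h0.ne',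
    Complex.circleIntegral_sub_center_inv_smul_eq_of_differentiable_on_annulus_off_countable
      h0 h1 hs]
  · refine hc.mono fun z hz => ?_
    simpa [closedAnnulus, and_comm] using hz
  · refine fun z hz => hd z ?_
    simpa [annulus, and_comm] using hz

theorem hasSum_circleAverage_geometric {R ρ : ℝ} (hR : 0 ≤ R) (hρ : ρ < 1) {q g : ℂ → ℂ}
    (hq : ContinuousOn q (Metric.sphere 0 R)) (hg : ContinuousOn g (Metric.sphere 0 R))
    (hb : ∀ z ∈ Metric.sphere (0 : ℂ) R, ‖q z‖ ≤ ρ) :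
    HasSum (fun n : ℕ => Real.circleAverage (fun z => q z ^ n * g z) 0 R)
      (Real.circleAverage (fun z => (1 - q z)⁻¹ * g z) 0 R) := by
  obtain ⟨C, hC⟩ := (isCompact_sphere (0 : ℂ) R).exists_bound_of_continuousOn hg
  have hm : ∀ θ, circleMap 0 R θ ∈ Metric.sphere (0 : ℂ) R := circleMap_mem_sphere 0 hR
  have hρ0 : 0 ≤ ρ := (norm_nonneg _).trans (hb _ (hm 0))
  have hqc : Continuous fun θ => q (circleMap 0 R θ) :=
    hq.comp_continuous (continuous_circleMap 0 R) hm
  have hgc : Continuous fun θ => g (circleMap 0 R θ) :=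
    hg.comp_continuous (continuous_circleMap 0 R) hm
  simp only [Real.circleAverage_def]
  refine HasSum.const_smul _ ?_
  refine intervalIntegral.hasSum_integral_of_dominated_convergence
    (fun n _ => ρ ^ n * C) (fun n => ?_) (fun n => ?_) ?_ ?_ ?_
  · exact ((hqc.pow n).mul hgc).aestronglyMeasurable
  · refine Eventually.of_forall fun θ _ => ?_
    rw [norm_mul, norm_pow]
    have := hb _ (hm θ)
    have := hC _ (hm θ)
    gcongr
  · exact Eventually.of_forall fun θ _ => (summable_geometric_of_lt_one hρ0 hρ).mul_right C
  · exact intervalIntegrable_const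
  · refine Eventually.of_forall fun θ _ => ?_
    exact (hasSum_geometric_of_norm_lt_one ((hb _ (hm θ)).trans_lt hρ)).mul_right _

/-- The coefficients of the Laurent expansion about `0`, computed on the unit circle. -/
noncomputable def laurentCoeff (f : ℂ → ℂ) (n : ℤ) : ℂ :=
  Real.circleAverage (fun ζ => ζ ^ (-n) * f ζ) 0 1

theorem laurentCoeff_eq_circleAverage {r : ℝ} (h0 : 0 < r) (h1 : r ≤ 1) {f : ℂ → ℂ}
    (hc : ContinuousOn f (closedAnnulus r)) (hd : DifferentiableOn ℂ f (annulus r)) (n : ℤ) :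
    laurentCoeff f n = Real.circleAverage (fun ζ => ζ ^ (-n) * f ζ) 0 r := by
  refine circleAverage_one_eq_circleAverage h0 h1 countable_empty ?_ ?_
  · exact ContinuousOn.mul (fun z hz => (continuousAt_zpow₀ z (-n)
      (Or.inl (ne_zero_of_mem_closedAnnulus h0 hz))).continuousWithinAt) hc
  · rintro z ⟨hz, -⟩
    exact (differentiableAt_zpow.2 (Or.inl (ne_zero_of_mem_closedAnnulus h0
      (annulus_subset_closedAnnulus r hz)))).mul (hd.differentiableAt
        ((isOpen_annulus r).mem_nhds hz))

/-- The quotient `dslope f z` has no singularity at `z`, so `ζ * dslope f z ζ` has equal averages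
over both circles. Splitting the quotient leaves the averages of `ζ / (ζ - z)`, which are `1`
outside and `0` inside. -/
theorem cauchy_formula_annulus {r : ℝ} (h0 : 0 < r) (h1 : r ≤ 1) {f : ℂ → ℂ}
    (hc : ContinuousOn f (closedAnnulus r)) (hd : DifferentiableOn ℂ f (annulus r)) {z : ℂ}
    (hz : z ∈ annulus r) :
    f z = Real.circleAverage (fun ζ => ζ * (ζ - z)⁻¹ * f ζ) 0 1 -
      Real.circleAverage (fun ζ => ζ * (ζ - z)⁻¹ * f ζ) 0 r := by
  have hdz : DifferentiableAt ℂ f z := hd.differentiableAt ((isOpen_annulus r).mem_nhds hz)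
  have hA : closedAnnulus r ∈ 𝓝 z :=
    mem_of_superset ((isOpen_annulus r).mem_nhds hz) (annulus_subset_closedAnnulus r)
  have key : Real.circleAverage (fun ζ => ζ * dslope f z ζ) 0 1 =
      Real.circleAverage (fun ζ => ζ * dslope f z ζ) 0 r := by
    refine circleAverage_one_eq_circleAverage h0 h1 (countable_singleton z) ?_ ?_
    · exact continuousOn_id.mul ((continuousOn_dslope hA).2 ⟨hc, hdz⟩)
    · rintro w ⟨hw, hwz⟩
      exact differentiableAt_id.mul ((differentiableAt_dslope_of_ne hwz).2
        (hd.differentiableAt ((isOpen_annulus r).mem_nhds hw)))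
  have hker : ∀ {R : ℝ}, R ≠ ‖z‖ →
      ContinuousOn (fun ζ : ℂ => ζ * (ζ - z)⁻¹) (Metric.sphere 0 R) := fun {R} hR =>
    continuousOn_id.mul (ContinuousOn.inv₀ (by fun_prop) fun ζ hζ h => hR (by
      rw [← mem_sphere_zero_iff_norm.1 hζ, sub_eq_zero.1 h]))
  have split : ∀ {R : ℝ}, 0 < R → R ≠ ‖z‖ → Metric.sphere (0 : ℂ) R ⊆ closedAnnulus r →
      Real.circleAverage (fun ζ => ζ * dslope f z ζ) 0 R =
        Real.circleAverage (fun ζ => ζ * (ζ - z)⁻¹ * f ζ) 0 R -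
          Real.circleAverage (fun ζ => ζ * (ζ - z)⁻¹) 0 R * f z := by
    intro R hR hRz hsub
    have e1 : Real.circleAverage (fun ζ => ζ * (ζ - z)⁻¹) 0 R * f z =
        Real.circleAverage (fun ζ => f z • (ζ * (ζ - z)⁻¹)) 0 R := by
      rw [Real.circleAverage_fun_smul, smul_eq_mul, mul_comm]
    rw [e1, ← Real.circleAverage_fun_sub]
    · refine Real.circleAverage_congr_sphere fun ζ hζ => ?_
      rw [abs_of_pos hR] at hζ
      have hne : ζ ≠ z := fun h => hRz (by rw [← mem_sphere_zero_iff_norm.1 hζ, h])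
      simp only [dslope_of_ne f hne, slope, vsub_eq_sub, smul_eq_mul]
      ring
    · exact ((hker hRz).mul (hc.mono hsub)).circleIntegrable hR.le
    · exact ((hker hRz).const_smul (f z)).circleIntegrable hR.le
  have h1z : (1 : ℝ) ≠ ‖z‖ := hz.2.ne'
  have hrz : r ≠ ‖z‖ := hz.1.ne
  rw [split one_pos h1z (sphere_one_subset_closedAnnulus h1),
    split h0 hrz (sphere_subset_closedAnnulus h1)] at key
  have a1 : Real.circleAverage (fun ζ => ζ * (ζ - z)⁻¹) 0 1 = 1 := by
    have := DiffContOnCl.circleAverage_smul_div (c := 0) (R := 1) (w := z)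
      (f := fun _ : ℂ => (1 : ℂ)) diffContOnCl_const (by simpa using hz.2)
    simpa [div_eq_mul_inv] using this
  -- The inner disc misses `z`, so the mean value property gives the value at the centre, which is
  -- `0`.
  have a2 : Real.circleAverage (fun ζ => ζ * (ζ - z)⁻¹) 0 r = 0 := by
    have hD : DifferentiableOn ℂ (fun ζ : ℂ => ζ * (ζ - z)⁻¹) (Metric.closedBall 0 r) := by
      refine differentiableOn_id.mul (DifferentiableOn.inv (by fun_prop) fun ζ hζ h => ?_)
      rw [mem_closedBall_zero_iff, sub_eq_zero.1 h] at hζ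
      exact hζ.not_gt hz.1
    have := DiffContOnCl.circleAverage (c := 0) (R := r) (f := fun ζ : ℂ => ζ * (ζ - z)⁻¹)
      (by
        rw [abs_of_pos h0]
        exact DifferentiableOn.diffContOnCl (by rwa [closure_ball _ h0.ne']))
    simpa using this
  rw [a1, a2] at key
  linear_combination -key

/-- The Laurent expansion of a function holomorphic on the annulus and continuous on its closure. -/
theorem hasSum_laurent {r : ℝ} (h0 : 0 < r) (h1 : r ≤ 1) {f : ℂ → ℂ}
    (hc : ContinuousOn f (closedAnnulus r)) (hd : DifferentiableOn ℂ f (annulus r)) {z : ℂ}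
    (hz : z ∈ annulus r) :
    HasSum (fun n : ℤ => z ^ n * laurentCoeff f n) (f z) := by
  have hz0 : z ≠ 0 := ne_zero_of_mem_closedAnnulus h0 (annulus_subset_closedAnnulus r hz)
  rw [cauchy_formula_annulus h0 h1 hc hd hz, sub_eq_add_neg]
  have hone : ∀ ζ ∈ Metric.sphere (0 : ℂ) 1, ζ ≠ 0 := fun ζ hζ => by
    rw [mem_sphere_zero_iff_norm] at hζ
    exact norm_pos_iff.1 (by rw [hζ]; exact one_pos)
  -- The outer circle is expanded in powers of `z/ζ` and gives the indices `n ≥ 0`. The inner one is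
  -- expanded in `ζ/z`; its extra factor `ζ/z` shifts the indices to `-(n+1)`.
  refine HasSum.of_nat_of_neg_add_one ?_ ?_
  · have := hasSum_circleAverage_geometric zero_le_one hz.2 (q := fun ζ => z * ζ⁻¹) (g := f)
      (continuousOn_const.mul (continuousOn_id.inv₀ hone))
      (hc.mono (sphere_one_subset_closedAnnulus h1)) fun ζ hζ => by
        rw [mem_sphere_zero_iff_norm] at hζ
        simp [hζ]
    convert! this using 1
    · ext n
      rw [laurentCoeff, ← smul_eq_mul, ← Real.circleAverage_fun_smul]
      congr with ζ
      simp only [smul_eq_mul, zpow_natCast, zpow_neg, mul_pow, inv_pow]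
      ring
    · refine Real.circleAverage_congr_sphere fun ζ hζ => ?_
      rw [abs_one] at hζ
      have hζ0 := hone ζ hζ
      have hne : ζ - z ≠ 0 := fun h => hz.2.ne (by
        rw [← sub_eq_zero.1 h, mem_sphere_zero_iff_norm.1 hζ])
      have : 1 - z * ζ⁻¹ = (ζ - z) * ζ⁻¹ := by field_simp
      simp only [this, mul_inv, inv_inv]
      ring
  · have hq : ContinuousOn (fun ζ : ℂ => ζ * z⁻¹) (Metric.sphere 0 r) := by fun_prop
    have hfr := hc.mono (sphere_subset_closedAnnulus h1)
    have := hasSum_circleAverage_geometric h0.le ((div_lt_one (h0.trans hz.1)).2 hz.1)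
      hq (hq.mul hfr) fun ζ hζ => by
        rw [mem_sphere_zero_iff_norm] at hζ
        simp [hζ, div_eq_mul_inv]
    convert! this using 1
    · ext n
      rw [laurentCoeff_eq_circleAverage h0 h1 hc hd, ← smul_eq_mul,
        ← Real.circleAverage_fun_smul]
      congr with ζ
      have : ((n : ℤ) + 1) = ((n + 1 : ℕ) : ℤ) := by push_cast; ring
      simp only [this, Pi.mul_apply, smul_eq_mul, zpow_natCast, zpow_neg, neg_neg, mul_pow, pow_succ, mul_inv,
        inv_pow]
      ring
    · rw [← neg_one_smul ℂ (Real.circleAverage _ _ _), ← Real.circleAverage_fun_smul]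
      refine Real.circleAverage_congr_sphere fun ζ hζ => ?_
      rw [abs_of_pos h0] at hζ
      have hne : z - ζ ≠ 0 := fun h => hz.1.ne' (by
        rw [sub_eq_zero.1 h, mem_sphere_zero_iff_norm.1 hζ])
      have e : 1 - ζ * z⁻¹ = (z - ζ) * z⁻¹ := by field_simp
      have e' : ζ - z = -(z - ζ) := by ring
      simp only [e, e', mul_inv, inv_inv, inv_neg, Pi.mul_apply, smul_eq_mul]
      field_simp

/-! ### The annulus as a smoothly bounded domain -/

/-- The strip is convex and its closure is explicit; connectedness and the closure of the annulus
are transported from it by `exp`. -/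
theorem exp_image_re_preimage_Ioo {r : ℝ} (h0 : 0 < r) :
    Complex.exp '' (Complex.re ⁻¹' Ioo (Real.log r) 0) = annulus r := by
  ext z
  constructor
  · rintro ⟨w, ⟨h1, h2⟩, rfl⟩
    change r < ‖Complex.exp w‖ ∧ ‖Complex.exp w‖ < 1
    rw [Complex.norm_exp]
    exact ⟨(Real.log_lt_iff_lt_exp h0).1 h1, (Real.exp_lt_exp.2 h2).trans_eq Real.exp_zero⟩
  · rintro ⟨h1, h2⟩
    have hz : 0 < ‖z‖ := h0.trans h1
    refine ⟨Complex.log z, ?_, Complex.exp_log (norm_pos_iff.1 hz)⟩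
    rw [mem_preimage, Complex.log_re]
    exact ⟨Real.log_lt_log h0 h1, Real.log_neg hz h2⟩

theorem isConnected_annulus {r : ℝ} (h0 : 0 < r) (h1 : r < 1) : IsConnected (annulus r) := by
  rw [← exp_image_re_preimage_Ioo h0]
  have hc : Convex ℝ (Complex.re ⁻¹' Ioo (Real.log r) 0) :=
    (convex_Ioo _ _).linear_preimage Complex.reLm
  have hn : (Complex.re ⁻¹' Ioo (Real.log r) 0).Nonempty :=
    (nonempty_Ioo.2 (Real.log_neg h0 h1)).preimage Complex.re_surjective
  exact (hc.isConnected hn).image _ Complex.continuous_exp.continuousOn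

theorem isCompact_closedAnnulus (r : ℝ) : IsCompact (closedAnnulus r) := by
  refine (isCompact_closedBall (0 : ℂ) 1).of_isClosed_subset ?_ fun z hz => by simpa using hz.2
  exact (isClosed_le continuous_const continuous_norm).inter
    (isClosed_le continuous_norm continuous_const)

theorem closure_annulus {r : ℝ} (h0 : 0 < r) (h1 : r < 1) :
    closure (annulus r) = closedAnnulus r := by
  refine subset_antisymm (closure_minimal (annulus_subset_closedAnnulus r)
    (isCompact_closedAnnulus r).isClosed) fun z hz => ?_
  rw [← exp_image_re_preimage_Ioo h0]
  refine image_closure_subset_closure_image Complex.continuous_exp ⟨Complex.log z, ?_,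
    Complex.exp_log (ne_zero_of_mem_closedAnnulus h0 hz)⟩
  rw [Complex.closure_preimage_re, closure_Ioo (Real.log_neg h0 h1).ne, mem_preimage,
    Complex.log_re]
  exact ⟨Real.log_le_log h0 hz.1, Real.log_nonpos (norm_nonneg z) hz.2⟩

theorem frontier_annulus {r : ℝ} (h0 : 0 < r) (h1 : r < 1) :
    frontier (annulus r) = Metric.sphere 0 1 ∪ Metric.sphere 0 r := by
  rw [(isOpen_annulus r).frontier_eq, closure_annulus h0 h1]
  ext z
  rw [mem_union, mem_sphere_zero_iff_norm, mem_sphere_zero_iff_norm]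
  constructor
  · rintro ⟨⟨h2, h3⟩, h4⟩
    by_contra! h5
    exact h4 ⟨lt_of_le_of_ne h2 h5.2.symm, lt_of_le_of_ne h3 h5.1⟩
  · rintro (h | h)
    · exact ⟨⟨by linarith, h.le⟩, fun h2 => h2.2.ne h⟩
    · exact ⟨⟨h.ge, by linarith⟩, fun h2 => h2.1.ne' h⟩

theorem frontier_annulus_subset {r : ℝ} (h0 : 0 < r) (h1 : r < 1) :
    frontier (annulus r) ⊆ closedAnnulus r := by
  rw [← closure_annulus h0 h1]
  exact frontier_subset_closure

theorem isSmoothlyBoundedDomain_annulus {r : ℝ} (h0 : 0 < r) (h1 : r < 1) :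
    IsSmoothlyBoundedDomain (annulus r) where
  isOpen := isOpen_annulus r
  isConnected := isConnected_annulus h0 h1
  isBounded := (isCompact_closedAnnulus r).isBounded.subset (annulus_subset_closedAnnulus r)
  exists_definingFunction := by
    have hfac : ∀ z : ℂ, (‖z‖ ^ 2 - 1) * (‖z‖ ^ 2 - r ^ 2) =
        (‖z‖ - 1) * (‖z‖ - r) * ((‖z‖ + 1) * (‖z‖ + r)) := fun z => by ring
    have hpos : ∀ z : ℂ, 0 < (‖z‖ + 1) * (‖z‖ + r) := fun z => by positivity
    refine ⟨fun z => (‖z‖ ^ 2 - 1) * (‖z‖ ^ 2 - r ^ 2), ?_, ?_, ?_, ?_⟩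
    · exact ((contDiff_norm_sq ℝ).sub contDiff_const).mul ((contDiff_norm_sq ℝ).sub contDiff_const)
    · ext z
      change (r < ‖z‖ ∧ ‖z‖ < 1) ↔ (‖z‖ ^ 2 - 1) * (‖z‖ ^ 2 - r ^ 2) < 0
      rw [hfac, mul_neg_iff]
      constructor
      · rintro ⟨h2, h3⟩
        exact Or.inr ⟨by nlinarith, hpos z⟩
      · rintro (h | ⟨h, -⟩)
        · exact absurd h.2 (hpos z).not_gt
        · rcases mul_neg_iff.1 h with h | h
          · exact absurd h1 (by linarith [h.1, h.2])
          · exact ⟨by linarith [h.2], by linarith [h.1]⟩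
    · ext z
      change z ∈ frontier (annulus r) ↔ (‖z‖ ^ 2 - 1) * (‖z‖ ^ 2 - r ^ 2) = 0
      rw [frontier_annulus h0 h1, hfac, mul_eq_zero, or_iff_left (hpos z).ne',
        mul_eq_zero, sub_eq_zero, sub_eq_zero]
      simp
    · intro z hz h
      have hd := ((hasStrictFDerivAt_norm_sq z).hasFDerivAt.sub_const 1).mul
        ((hasStrictFDerivAt_norm_sq z).hasFDerivAt.sub_const (r ^ 2))
      -- In the radial direction `z` the differential is `2|z|² ((|z|² - 1) + (|z|² - r²))`, nonzero
      -- on both circles.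
      have := DFunLike.congr_fun (hd.fderiv.symm.trans h) z
      simp only [_root_.add_apply, _root_.smul_apply,
        innerSL_apply_apply, real_inner_self_eq_norm_sq, smul_eq_mul,
        _root_.zero_apply, nsmul_eq_mul] at this
      rw [frontier_annulus h0 h1] at hz
      simp only [mem_union, mem_sphere_zero_iff_norm] at hz
      rcases hz with hz | hz
      · rw [hz] at this
        push_cast at this
        nlinarith
      · rw [hz] at this
        push_cast at this
        have h2 : r ^ 2 * (r ^ 2 - 1) = 0 := by linarith
        have h3 : 0 < r ^ 2 * (1 - r ^ 2) := mul_pos (by positivity) (by nlinarith)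
        linarith

/-! ### Boundary integrals and monomials -/

theorem isFiniteMeasure_arcLength_annulus {r : ℝ} (h0 : 0 < r) (h1 : r < 1) :
    IsFiniteMeasure (arcLength (annulus r)) := ⟨by
  rw [arcLength, Measure.restrict_apply_univ, frontier_annulus h0 h1]
  refine (measure_union_le _ _).trans_lt ?_
  rw [hausdorffMeasure_sphere one_pos, hausdorffMeasure_sphere h0]
  exact ENNReal.add_lt_top.2 ⟨ENNReal.ofReal_lt_top, ENNReal.ofReal_lt_top⟩⟩

theorem ae_arcLength_mem_closedAnnulus {r : ℝ} (h0 : 0 < r) (h1 : r < 1) :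
    ∀ᵐ z ∂arcLength (annulus r), z ∈ closedAnnulus r := by
  filter_upwards [ae_restrict_mem (μ := (Measure.hausdorffMeasure 1 : Measure ℂ))
    (isClosed_frontier (s := annulus r)).measurableSet] with z hz
  exact frontier_annulus_subset h0 h1 hz

theorem memLp_arcLength_annulus {r : ℝ} (h0 : 0 < r) (h1 : r < 1) {g : ℂ → ℂ}
    (hg : ContinuousOn g (closedAnnulus r)) (p : ENNReal) :
    MemLp g p (arcLength (annulus r)) := by
  have := isFiniteMeasure_arcLength_annulus h0 h1
  obtain ⟨C, hC⟩ := (isCompact_closedAnnulus r).exists_bound_of_continuousOn hg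
  refine MemLp.of_bound ?_ C ((ae_arcLength_mem_closedAnnulus h0 h1).mono hC)
  exact (hg.mono (frontier_annulus_subset h0 h1)).aestronglyMeasurable
    isClosed_frontier.measurableSet

theorem integral_arcLength_annulus {r : ℝ} (h0 : 0 < r) (h1 : r < 1) {g : ℂ → ℂ}
    (hg : ContinuousOn g (closedAnnulus r)) :
    ∫ z, g z ∂arcLength (annulus r) =
      unitCircleLength * (Real.circleAverage g 0 1 + r * Real.circleAverage g 0 r) := by
  have hi : IntegrableOn g (Metric.sphere 0 1 ∪ Metric.sphere 0 r)
      (Measure.hausdorffMeasure 1 : Measure ℂ) := by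
    rw [← frontier_annulus h0 h1]
    exact memLp_one_iff_integrable.1 (memLp_arcLength_annulus h0 h1 hg 1)
  rw [arcLength, frontier_annulus h0 h1, setIntegral_union ?_ Metric.isClosed_sphere.measurableSet
    hi.left_of_union hi.right_of_union,
    setIntegral_sphere one_pos (hg.mono (sphere_one_subset_closedAnnulus h1.le)),
    setIntegral_sphere h0 (hg.mono (sphere_subset_closedAnnulus h1.le))]
  · push_cast
    ring
  · rw [disjoint_left]
    intro z hz hz'
    rw [mem_sphere_zero_iff_norm] at hz hz'
    linarith

theorem continuousOn_zpow_closedAnnulus {r : ℝ} (h0 : 0 < r) (n : ℤ) :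
    ContinuousOn (fun z : ℂ => z ^ n) (closedAnnulus r) := fun z hz =>
  (continuousAt_zpow₀ z n (Or.inl (ne_zero_of_mem_closedAnnulus h0 hz))).continuousWithinAt

theorem zpow_mem_smoothHolomorphic {r : ℝ} (h0 : 0 < r) (h1 : r < 1) (n : ℤ) :
    (fun z : ℂ => z ^ n) ∈ smoothHolomorphic (annulus r) := by
  have hd : DifferentiableOn ℂ (fun z : ℂ => z ^ n) {0}ᶜ := fun z hz =>
    (differentiableAt_zpow.2 (Or.inl hz)).differentiableWithinAt
  have hsub : closedAnnulus r ⊆ {0}ᶜ := fun z hz => ne_zero_of_mem_closedAnnulus h0 hz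
  refine ⟨hd.mono ((annulus_subset_closedAnnulus r).trans hsub), ?_⟩
  rw [closure_annulus h0 h1]
  exact ((hd.contDiffOn isOpen_compl_singleton).restrict_scalars ℝ).mono hsub

/-- The boundary trace of `z ^ n` on the annulus (and zero for degenerate radii). -/
noncomputable def monomialTrace (r : ℝ) (n : ℤ) : Lp ℂ 2 (arcLength (annulus r)) :=
  open Classical in
  if h : MemLp (fun z : ℂ => z ^ n) 2 (arcLength (annulus r)) then h.toLp _ else 0

theorem isTrace_monomialTrace {r : ℝ} (h0 : 0 < r) (h1 : r < 1) (n : ℤ) :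
    IsTrace (annulus r) (fun z => z ^ n) (monomialTrace r n) := by
  have h := memLp_arcLength_annulus h0 h1 (continuousOn_zpow_closedAnnulus h0 n) 2
  rw [IsTrace, monomialTrace, dif_pos h]
  exact h.coeFn_toLp

/-- The squared norm of `z ^ n` in the Hardy space of the annulus. -/
noncomputable def monomialWeight (r : ℝ) (n : ℤ) : ℝ := unitCircleLength * (1 + r ^ (2 * n + 1))

theorem monomialWeight_pos {r : ℝ} (h0 : 0 < r) (n : ℤ) : 0 < monomialWeight r n :=
  mul_pos unitCircleLength_pos (by positivity)

/-- On `|ζ| = R` one has `conj ζ = R² / ζ`, so pairing with `ζ ^ n` gives `R ^ (2n)` times the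
Laurent coefficient, the same on both circles. With arc length proportional to `R`, the total weight
is `1 + r * r ^ (2n)`. -/
theorem inner_monomialTrace {r : ℝ} (h0 : 0 < r) (h1 : r < 1) (n : ℤ) {f : ℂ → ℂ}
    (hf : f ∈ smoothHolomorphic (annulus r)) {u : Lp ℂ 2 (arcLength (annulus r))}
    (hu : IsTrace (annulus r) f u) :
    inner ℂ (monomialTrace r n) u = monomialWeight r n * laurentCoeff f n := by
  have hc : ContinuousOn f (closedAnnulus r) := by
    rw [← closure_annulus h0 h1]
    exact hf.2.continuousOn
  rw [← integral_conj_mul_eq_inner]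
  have hae : (fun ζ => conj (monomialTrace r n ζ) * u ζ) =ᵐ[arcLength (annulus r)]
      fun ζ => conj (ζ ^ n) * f ζ := by
    filter_upwards [isTrace_monomialTrace h0 h1 n, hu] with ζ h2 h3
    rw [h2, h3]
  have key : ∀ {R : ℝ}, 0 < R → Real.circleAverage (fun ζ => conj (ζ ^ n) * f ζ) 0 R =
      ((R ^ (2 * n) : ℝ) : ℂ) * Real.circleAverage (fun ζ => ζ ^ (-n) * f ζ) 0 R := by
    intro R hR
    rw [← smul_eq_mul, ← Real.circleAverage_fun_smul]
    refine Real.circleAverage_congr_sphere fun ζ hζ => ?_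
    rw [abs_of_pos hR, mem_sphere_zero_iff_norm] at hζ
    have hζ0 : ζ ≠ 0 := norm_pos_iff.1 (hζ ▸ hR)
    have : conj ζ = ((R ^ 2 : ℝ) : ℂ) * ζ⁻¹ := by
      rw [eq_mul_inv_iff_mul_eq₀ hζ0, mul_comm, Complex.mul_conj, Complex.normSq_eq_norm_sq, hζ]
    simp only [map_zpow₀, this, mul_zpow, inv_zpow', smul_eq_mul, zpow_mul]
    push_cast
    rw [mul_assoc]
    norm_cast
  rw [integral_congr_ae hae, integral_arcLength_annulus h0 h1 (g := fun ζ => conj (ζ ^ n) * f ζ)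
    ((Complex.continuous_conj.comp_continuousOn (continuousOn_zpow_closedAnnulus h0 n)).mul hc),
    key one_pos, key h0, ← laurentCoeff_eq_circleAverage h0 h1.le hc hf.1, ← laurentCoeff,
    monomialWeight]
  rw [zpow_add₀ h0.ne']
  simp
  ring

theorem norm_monomialTrace_sq {r : ℝ} (h0 : 0 < r) (h1 : r < 1) (n : ℤ) :
    ‖monomialTrace r n‖ ^ 2 = monomialWeight r n := by
  have h := inner_monomialTrace h0 h1 n (zpow_mem_smoothHolomorphic h0 h1 n)
    (isTrace_monomialTrace h0 h1 n)
  have h2 : laurentCoeff (fun z => z ^ n) n = 1 := by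
    rw [laurentCoeff, ← Real.circleAverage_const (1 : ℂ) 0 1]
    refine Real.circleAverage_congr_sphere fun ζ hζ => ?_
    rw [abs_one, mem_sphere_zero_iff_norm] at hζ
    have hζ0 : ζ ≠ 0 := norm_pos_iff.1 (hζ ▸ one_pos)
    simp only [zpow_neg]
    exact inv_mul_cancel₀ (zpow_ne_zero n hζ0)
  rw [h2, mul_one, inner_self_eq_norm_sq_to_K] at h
  exact Complex.ofReal_injective (by simpa using h)

/-! ### The kernel series and its reproducing property -/

/-- Here `max 1 (r ^ n)` bounds `|w| ^ n` on the closed annulus. The terms are geometric with ratio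
`x` for `n ≥ 0` and `r / x` for `n < 0`. -/
theorem summable_zpow_div_max {r x : ℝ} (h0 : 0 < r) (hrx : r < x) (hx : x < 1) :
    Summable fun n : ℤ => x ^ n / max 1 (r ^ n) := by
  have hx0 : 0 < x := h0.trans hrx
  refine Summable.of_nat_of_neg_add_one ?_ ?_
  · refine (summable_geometric_of_lt_one hx0.le hx).congr fun n => ?_
    rw [max_eq_left, div_one, zpow_natCast]
    rw [zpow_natCast]
    exact pow_le_one₀ h0.le (hrx.trans hx).le
  · have hs := (summable_geometric_of_lt_one (div_pos h0 hx0).le ((div_lt_one hx0).2 hrx)).mul_left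
      (r / x)
    refine hs.congr fun n => ?_
    have e : -((n : ℤ) + 1) = -((n + 1 : ℕ) : ℤ) := by push_cast; ring
    rw [e, zpow_neg, zpow_neg, zpow_natCast, zpow_natCast, max_eq_right, ← pow_succ', div_pow,
      inv_div_inv]
    exact (one_le_inv₀ (by positivity)).2 (pow_le_one₀ h0.le (hrx.trans hx).le)

/-- The squared norm of `z ^ n` dominates its squared supremum up to a constant, so one summable
bound serves both uniform and `L²` convergence of the kernel series. -/
theorem le_monomialWeight {r : ℝ} (h0 : 0 < r) (h1 : r < 1) (n : ℤ) :
    unitCircleLength * r * max 1 (r ^ n) ^ 2 ≤ monomialWeight r n := by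
  rw [monomialWeight, mul_assoc]
  refine mul_le_mul_of_nonneg_left ?_ unitCircleLength_pos.le
  have e : r ^ (2 * n + 1) = r * (r ^ n) ^ 2 := by
    rw [zpow_add₀ h0.ne', zpow_one, mul_comm 2 n, zpow_mul]
    norm_cast
    ring
  rw [e]
  have : 0 < r ^ n := by positivity
  rcases max_choice 1 (r ^ n) with h | h <;> rw [h]
  · have : 0 ≤ r * (r ^ n) ^ 2 := by positivity
    linarith
  · linarith

theorem norm_zpow_le_max {r : ℝ} (h0 : 0 < r) {w : ℂ} (hw : w ∈ closedAnnulus r) (n : ℤ) :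
    ‖w‖ ^ n ≤ max 1 (r ^ n) := by
  have hw0 : 0 < ‖w‖ := h0.trans_le hw.1
  rcases n with n | n
  · refine le_max_of_le_left ?_
    simpa using pow_le_one₀ (norm_nonneg w) hw.2
  · refine le_max_of_le_right ?_
    rw [zpow_negSucc, zpow_negSucc]
    exact inv_anti₀ (by positivity) (pow_le_pow_left₀ h0.le hw.1 _)

/-- The Szegő kernel of the annulus as a bilateral power series. -/
noncomputable def annulusKernel (r : ℝ) (w z : ℂ) : ℂ :=
  ∑' n : ℤ, conj z ^ n / monomialWeight r n * w ^ n

theorem norm_annulusKernel_term_le {r : ℝ} (h0 : 0 < r) (h1 : r < 1) {w : ℂ}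
    (hw : w ∈ closedAnnulus r) (z : ℂ) (n : ℤ) :
    ‖conj z ^ n / monomialWeight r n * w ^ n‖ ≤
      ‖z‖ ^ n / max 1 (r ^ n) * (unitCircleLength * r)⁻¹ := by
  have hc := unitCircleLength_pos
  have hN := monomialWeight_pos h0 n
  have hm : 0 < max 1 (r ^ n) := lt_max_of_lt_left one_pos
  rw [norm_mul, norm_div, norm_zpow, norm_zpow, RCLike.norm_conj, Complex.norm_real,
    Real.norm_of_nonneg hN.le]
  calc ‖z‖ ^ n / monomialWeight r n * ‖w‖ ^ n
      ≤ ‖z‖ ^ n / (unitCircleLength * r * max 1 (r ^ n) ^ 2) * max 1 (r ^ n) := by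
        gcongr
        · exact le_monomialWeight h0 h1 n
        · exact norm_zpow_le_max h0 hw n
    _ = _ := by field_simp

theorem summable_annulusKernel_bound {r : ℝ} (h0 : 0 < r) {z : ℂ} (hz : z ∈ annulus r) :
    Summable fun n : ℤ => ‖z‖ ^ n / max 1 (r ^ n) * (unitCircleLength * r)⁻¹ :=
  (summable_zpow_div_max h0 hz.1 hz.2).mul_right _

theorem summable_smul_monomialTrace {r : ℝ} (h0 : 0 < r) (h1 : r < 1) {z : ℂ}
    (hz : z ∈ annulus r) :
    Summable fun n : ℤ => (conj z ^ n / (monomialWeight r n : ℂ)) • monomialTrace r n := by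
  have hc := unitCircleLength_pos
  refine Summable.of_norm_bounded
    ((summable_zpow_div_max h0 hz.1 hz.2).mul_right (√(unitCircleLength * r))⁻¹) fun n => ?_
  have hN := monomialWeight_pos h0 n
  have he : ‖monomialTrace r n‖ = √(monomialWeight r n) := by
    rw [← norm_monomialTrace_sq h0 h1, Real.sqrt_sq (norm_nonneg _)]
  have hm : 0 < max 1 (r ^ n) := lt_max_of_lt_left one_pos
  rw [norm_smul, norm_div, norm_zpow, RCLike.norm_conj, Complex.norm_real,
    Real.norm_of_nonneg hN.le, he, div_mul_eq_mul_div, mul_div_assoc, Real.sqrt_div_self',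
    div_mul_eq_mul_div, mul_div_assoc]
  refine mul_le_mul_of_nonneg_left ?_ (by positivity)
  rw [inv_eq_one_div, div_div, ← Real.sqrt_sq hm.le, ← Real.sqrt_mul (by positivity)]
  exact one_div_le_one_div_of_le (by positivity) (Real.sqrt_le_sqrt (le_monomialWeight h0 h1 n))

/-- The boundary function of the Szegő kernel of the annulus. -/
noncomputable def kernelTrace (r : ℝ) (z : ℂ) : Lp ℂ 2 (arcLength (annulus r)) :=
  ∑' n : ℤ, (conj z ^ n / (monomialWeight r n : ℂ)) • monomialTrace r n

theorem isTrace_sum {Ω : Set ℂ} {ι : Type*} (s : Finset ι) (c : ι → ℂ) {f : ι → ℂ → ℂ}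
    {u : ι → Lp ℂ 2 (arcLength Ω)} (h : ∀ i, IsTrace Ω (f i) (u i)) :
    IsTrace Ω (∑ i ∈ s, c i • f i) (∑ i ∈ s, c i • u i) := by
  classical
  induction s using Finset.induction_on with
  | empty =>
    rw [Finset.sum_empty, Finset.sum_empty]
    exact Lp.coeFn_zero ℂ 2 (arcLength Ω)
  | insert i s hi ih =>
    rw [Finset.sum_insert hi, Finset.sum_insert hi]
    exact (Lp.coeFn_add _ _).trans
      (((Lp.coeFn_smul (c i) (u i)).trans ((h i).const_smul (c i))).add ih)

theorem tendsto_Icc_neg_natCast : Tendsto (fun N : ℕ => Finset.Icc (-N : ℤ) N) atTop atTop :=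
  Finset.tendsto_Icc_neg_atTop_atTop.comp tendsto_natCast_atTop_atTop

theorem isHolomorphicExtension_kernelTrace {r : ℝ} (h0 : 0 < r) (h1 : r < 1) {z : ℂ}
    (hz : z ∈ annulus r) :
    IsHolomorphicExtension (annulus r) (kernelTrace r z) (fun w => annulusKernel r w z) := by
  have hb := summable_annulusKernel_bound h0 hz
  have hle : ∀ (n : ℤ) (w : ℂ), w ∈ annulus r → ‖conj z ^ n / monomialWeight r n * w ^ n‖ ≤
      ‖z‖ ^ n / max 1 (r ^ n) * (unitCircleLength * r)⁻¹ := fun n w hw =>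
    norm_annulusKernel_term_le h0 h1 (annulus_subset_closedAnnulus r hw) z n
  refine ⟨?_, fun N => ∑ n ∈ Finset.Icc (-N : ℤ) N,
      (conj z ^ n / (monomialWeight r n : ℂ)) • fun w : ℂ => w ^ n,
    fun N => ∑ n ∈ Finset.Icc (-N : ℤ) N,
      (conj z ^ n / (monomialWeight r n : ℂ)) • monomialTrace r n, fun N => ⟨?_, ?_⟩, ?_, ?_⟩
  · exact Complex.differentiableOn_tsum_of_summable_norm hb
      (fun n => (zpow_mem_smoothHolomorphic h0 h1 n).1.const_mul _) (isOpen_annulus r) hle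
  · exact Submodule.sum_mem _ fun n _ =>
      Submodule.smul_mem _ _ (zpow_mem_smoothHolomorphic h0 h1 n)
  · exact isTrace_sum _ _ (isTrace_monomialTrace h0 h1)
  · exact (summable_smul_monomialTrace h0 h1 hz).hasSum.comp tendsto_Icc_neg_natCast
  · have hu := tendstoUniformlyOn_tsum hb hle
    refine TendstoUniformlyOn.tendstoLocallyUniformlyOn fun V hV => ?_
    filter_upwards [tendsto_Icc_neg_natCast.eventually (hu V hV)] with N hN w hw
    simpa [annulusKernel, Finset.sum_apply] using hN w hw

theorem IsHolomorphicExtension.mem_hardySpace {Ω : Set ℂ} {u : Lp ℂ 2 (arcLength Ω)} {F : ℂ → ℂ}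
    (h : IsHolomorphicExtension Ω u F) : u ∈ hardySpace Ω := by
  obtain ⟨-, f, t, hft, ht, -⟩ := h
  exact mem_closure_of_tendsto ht (Eventually.of_forall fun n => ⟨f n, hft n⟩)

/-- Pairing the series of `kernelTrace` with `u` term by term yields the Laurent series of `f` at
`z`: each weight cancels against the one in `inner_monomialTrace`. -/
theorem eq_inner_kernelTrace {r : ℝ} (h0 : 0 < r) (h1 : r < 1) {z : ℂ} (hz : z ∈ annulus r)
    {f : ℂ → ℂ} (hf : f ∈ smoothHolomorphic (annulus r)) {u : Lp ℂ 2 (arcLength (annulus r))}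
    (hu : IsTrace (annulus r) f u) : f z = inner ℂ (kernelTrace r z) u := by
  have hs := (innerSLFlip ℂ u).hasSum (summable_smul_monomialTrace h0 h1 hz).hasSum
  have hc : ContinuousOn f (closedAnnulus r) := by
    rw [← closure_annulus h0 h1]
    exact hf.2.continuousOn
  refine (hasSum_laurent h0 h1.le hc hf.1 hz).unique (hs.congr_fun fun n => ?_)
  have hN : (monomialWeight r n : ℂ) ≠ 0 := by exact_mod_cast (monomialWeight_pos h0 n).ne'
  rw [innerSLFlip_apply_apply, inner_smul_left, inner_monomialTrace h0 h1 n hf hu]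
  simp only [map_div₀, map_zpow₀, Complex.conj_conj, Complex.conj_ofReal]
  field_simp

theorem isSzegoKernel_annulusKernel {r : ℝ} (h0 : 0 < r) (h1 : r < 1) :
    IsSzegoKernel (annulus r) (annulusKernel r) where
  hermitian z _ w _ := by
    rw [annulusKernel, annulusKernel, Complex.conj_tsum]
    congr with n
    simp only [map_mul, map_div₀, map_zpow₀, Complex.conj_conj, Complex.conj_ofReal]
    ring
  reproducing z hz := by
    have hext := isHolomorphicExtension_kernelTrace h0 h1 hz
    refine ⟨kernelTrace r z, hext.mem_hardySpace, hext, ?_⟩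
    rintro u - F ⟨-, f, t, hft, ht, hF⟩
    rw [integral_conj_mul_eq_inner]
    -- The identity holds for the smooth approximants; both sides pass to the limit, pointwise at
    -- `z` and in `L²`.
    refine tendsto_nhds_unique (hF.tendsto_at hz) ?_
    simp only [fun n => eq_inner_kernelTrace h0 h1 hz (hft n).1 (hft n).2]
    exact tendsto_const_nhds.inner ht

theorem isSzegoKernel_szegoKernel_annulus {r : ℝ} (h0 : 0 < r) (h1 : r < 1) :
    IsSzegoKernel (annulus r) (szegoKernel (annulus r)) :=
  Classical.epsilon_spec (p := IsSzegoKernel (annulus r)) ⟨_, isSzegoKernel_annulusKernel h0 h1⟩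

theorem hasSum_szegoDiag_annulus {r : ℝ} (h0 : 0 < r) (h1 : r < 1) {z : ℂ} (hz : z ∈ annulus r) :
    HasSum (fun n : ℤ => ‖z‖ ^ (2 * n) / monomialWeight r n) (szegoDiag (annulus r) z) := by
  have hs : Summable fun n : ℤ => conj z ^ n / monomialWeight r n * z ^ n :=
    Summable.of_norm_bounded (summable_annulusKernel_bound h0 hz) fun n =>
      norm_annulusKernel_term_le h0 h1 (annulus_subset_closedAnnulus r hz) z n
  rw [szegoDiag, (isSzegoKernel_szegoKernel_annulus h0 h1).eq (isSzegoKernel_annulusKernel h0 h1)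
    hz hz]
  convert! Complex.hasSum_re hs.hasSum using 2 with n
  have : conj z ^ n / monomialWeight r n * z ^ n =
      ((‖z‖ ^ (2 * n) / monomialWeight r n : ℝ) : ℂ) := by
    rw [div_mul_eq_mul_div, ← mul_zpow, Complex.conj_mul', zpow_mul]
    push_cast
    norm_cast
  rw [this, Complex.ofReal_re]

/-! ### The Laplacian of radial functions -/

theorem hasFDerivAt_log_norm {w : ℂ} (hw : w ≠ 0) :
    HasFDerivAt (fun w : ℂ => Real.log ‖w‖) ((‖w‖ ^ 2)⁻¹ • innerSL ℝ w) w := by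
  have hn : ‖w‖ ^ 2 ≠ 0 := by positivity
  have h := ((hasStrictFDerivAt_norm_sq w).hasFDerivAt.log hn).const_mul (1 / 2)
  have e : (fun w : ℂ => Real.log ‖w‖) = fun w => 1 / 2 * Real.log (‖w‖ ^ 2) := by
    ext w
    rw [Real.log_pow]
    push_cast
    ring
  rw [e]
  refine h.congr_fderiv ?_
  ext v
  simp
  ring

/-- The Laplacian of a radial function, in terms of the logarithm of the radius. -/
theorem laplacian_comp_log_norm {h h' : ℝ → ℝ} {h'' : ℝ} {z : ℂ} (hz : z ≠ 0)
    (h1 : ∀ᶠ t in 𝓝 (Real.log ‖z‖), HasDerivAt h (h' t) t)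
    (h2 : HasDerivAt h' h'' (Real.log ‖z‖)) :
    Laplacian.laplacian (fun w : ℂ => h (Real.log ‖w‖)) z = h'' / ‖z‖ ^ 2 := by
  have hn : ‖z‖ ^ 2 ≠ 0 := by positivity
  have hlog := hasFDerivAt_log_norm hz
  have e1 : fderiv ℝ (fun w : ℂ => h (Real.log ‖w‖)) =ᶠ[𝓝 z]
      fun w => (h' (Real.log ‖w‖) * (‖w‖ ^ 2)⁻¹) • innerSL ℝ w := by
    filter_upwards [hlog.continuousAt.eventually h1, isOpen_ne.mem_nhds hz] with w hw hw0
    rw [mul_smul]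
    exact (hw.comp_hasFDerivAt w (hasFDerivAt_log_norm hw0)).fderiv
  have d1 : HasFDerivAt (fun w : ℂ => h' (Real.log ‖w‖) * (‖w‖ ^ 2)⁻¹) _ z :=
    (h2.comp_hasFDerivAt z hlog).mul
      ((hasDerivAt_inv hn).comp_hasFDerivAt z (hasStrictFDerivAt_norm_sq z).hasFDerivAt)
  have d2 := d1.smul (innerSL ℝ (E := ℂ)).hasFDerivAt
  have key : ∀ v : ℂ, iteratedFDeriv ℝ 2 (fun w : ℂ => h (Real.log ‖w‖)) z ![v, v] =
      h' (Real.log ‖z‖) * (‖z‖ ^ 2)⁻¹ * ‖v‖ ^ 2 +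
        (h'' - 2 * h' (Real.log ‖z‖)) * (‖z‖ ^ 2)⁻¹ ^ 2 * inner ℝ z v ^ 2 := by
    intro v
    rw [iteratedFDeriv_two_apply, e1.fderiv_eq]
    simp only [Matrix.cons_val_zero, Matrix.cons_val_one]
    rw [show fderiv ℝ (fun w : ℂ => (h' (Real.log ‖w‖) * (‖w‖ ^ 2)⁻¹) • innerSL ℝ w) z = _ from
      d2.fderiv]
    simp [-Complex.inner]
    rw [innerSL_apply_apply, innerSL_apply_apply, real_inner_self_eq_norm_sq]
    field_simp
    ring
  rw [laplacian_eq_iteratedFDeriv_complexPlane]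
  simp only [key]
  -- Summing over the orthonormal basis `1, I` cancels the `h'` terms, since `log ‖w‖` is harmonic
  -- away from `0`.
  have h3 : inner ℝ z 1 ^ 2 + inner ℝ z Complex.I ^ 2 = ‖z‖ ^ 2 := by
    rw [Complex.sq_norm, Complex.normSq_apply]
    simp [Complex.inner]
    ring
  have h4 : h' (Real.log ‖z‖) * (‖z‖ ^ 2)⁻¹ * 2 +
      (h'' - 2 * h' (Real.log ‖z‖)) * (‖z‖ ^ 2)⁻¹ ^ 2 *
        (inner ℝ z 1 ^ 2 + inner ℝ z Complex.I ^ 2) = h'' / ‖z‖ ^ 2 := by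
    rw [h3]
    field_simp
    ring
  rw [← h4]
  simp [-Complex.inner]
  ring

/-! ### The kernel as a moment generating function -/

/-- The odd integers, enumerated by all integers. -/
def oddInt (n : ℤ) : ℝ := 2 * n + 1

/-- The weight `1 / (2 cosh ((2n+1)L/2))`. -/
noncomputable def sechWeight (L : ℝ) (n : ℤ) : ℝ := (2 * Real.cosh (oddInt n * (L / 2)))⁻¹

theorem sechWeight_pos (L : ℝ) (n : ℤ) : 0 < sechWeight L n := by
  have := Real.cosh_pos (oddInt n * (L / 2))
  rw [sechWeight]
  positivity

/-- The measure on the integers with weights `1 / (2 cosh ((2n+1)L/2))`. Its moment generating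
function is, up to elementary factors, the Szegő kernel of the annulus on the diagonal. -/
noncomputable def sechMeasure (L : ℝ) : Measure ℤ :=
  Measure.sum fun n => ENNReal.ofReal (sechWeight L n) • Measure.dirac n

theorem integral_sechMeasure (L : ℝ) (f : ℤ → ℝ) :
    ∫ n, f n ∂sechMeasure L = ∑' n, sechWeight L n * f n := by
  rw [sechMeasure, integral_sum_dirac (fun _ => ENNReal.ofReal_ne_top)]
  congr with n
  rw [ENNReal.toReal_ofReal (sechWeight_pos L n).le, smul_eq_mul]

theorem integrable_sechMeasure (L : ℝ) {f : ℤ → ℝ} (hf : Summable fun n => sechWeight L n * f n) :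
    Integrable f (sechMeasure L) := by
  refine integrable_sum_dirac (fun _ => ENNReal.ofReal_ne_top) (hf.norm.congr fun n => ?_)
  rw [ENNReal.toReal_ofReal (sechWeight_pos L n).le, norm_mul,
    Real.norm_of_nonneg (sechWeight_pos L n).le]

theorem sechMeasure_singleton (L : ℝ) (n : ℤ) :
    sechMeasure L {n} = ENNReal.ofReal (sechWeight L n) := by
  rw [sechMeasure, Measure.sum_apply _ (measurableSet_singleton n), tsum_eq_single n]
  · simp
  · intro m hm
    simp [hm]

theorem ae_sechMeasure_iff (L : ℝ) {p : ℤ → Prop} : (∀ᵐ n ∂sechMeasure L, p n) ↔ ∀ n, p n := by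
  refine ⟨fun h n => ?_, Eventually.of_forall⟩
  by_contra hn
  have h1 : sechMeasure L {n} ≤ 0 := by
    rw [ae_iff] at h
    exact h ▸ measure_mono (by simpa using hn)
  rw [sechMeasure_singleton, nonpos_iff_eq_zero, ENNReal.ofReal_eq_zero] at h1
  exact h1.not_gt (sechWeight_pos L n)

theorem sechMeasure_ne_zero (L : ℝ) : sechMeasure L ≠ 0 := fun h =>
  absurd ((ae_sechMeasure_iff L (p := fun _ => False)).1 (by simp [h])) (by simp)

/-- The factor `|z|` turns `|z| ^ (2n)` into `|z| ^ (2n+1)`. Extracting `r ^ ((2n+1)/2)` from `1 + r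
^ (2n+1)` leaves a `cosh` and shifts `log |z|` by `L/2`, which puts the middle circle at `0`. -/
theorem hasSum_sechWeight_mul_exp {L : ℝ} (hL : 0 < L) {z : ℂ}
    (hz : z ∈ annulus (Real.exp (-L))) :
    HasSum (fun n => sechWeight L n * Real.exp ((Real.log ‖z‖ + L / 2) * oddInt n))
      (unitCircleLength * ‖z‖ * szegoDiag (annulus (Real.exp (-L))) z) := by
  have hz0 : 0 < ‖z‖ := (Real.exp_pos _).trans hz.1
  have hc := unitCircleLength_pos
  convert! (hasSum_szegoDiag_annulus (Real.exp_pos _) (by simpa using hL) hz).mul_left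
    (unitCircleLength * ‖z‖) using 2 with n
  have e1 : ‖z‖ * ‖z‖ ^ (2 * n) = Real.exp (Real.log ‖z‖ * oddInt n) := by
    rw [← zpow_one_add₀ hz0.ne', ← Real.rpow_intCast, Real.rpow_def_of_pos hz0, oddInt]
    push_cast
    ring_nf
  have e2 : Real.exp (-L) ^ (2 * n + 1) = Real.exp (-(oddInt n * (L / 2))) ^ 2 := by
    rw [← Real.rpow_intCast, ← Real.exp_mul, ← Real.exp_nat_mul, oddInt]
    push_cast
    ring_nf
  rw [monomialWeight, e2, mul_div_assoc', mul_assoc, e1, mul_div_mul_left _ _ hc.ne', sechWeight,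
    Real.cosh_eq, add_mul, Real.exp_add, mul_comm (L / 2), Real.exp_neg]
  field_simp

theorem log_norm_add_mem_Ioo {L : ℝ} {z : ℂ} (hz : z ∈ annulus (Real.exp (-L))) :
    Real.log ‖z‖ + L / 2 ∈ Ioo (-(L / 2)) (L / 2) := by
  have hz0 : 0 < ‖z‖ := (Real.exp_pos _).trans hz.1
  have h1 := (Real.lt_log_iff_exp_lt hz0).2 hz.1
  have h2 := Real.log_neg hz0 hz.2
  constructor <;> linarith

theorem exp_mem_annulus {L y : ℝ} (hy : y ∈ Ioo (-(L / 2)) (L / 2)) :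
    (Real.exp (y - L / 2) : ℂ) ∈ annulus (Real.exp (-L)) := by
  change Real.exp (-L) < ‖(Real.exp (y - L / 2) : ℂ)‖ ∧ ‖(Real.exp (y - L / 2) : ℂ)‖ < 1
  rw [Complex.norm_real, Real.norm_of_nonneg (Real.exp_pos _).le, Real.exp_lt_exp]
  refine ⟨by linarith [hy.1], (Real.exp_lt_exp.2 ?_).trans_eq Real.exp_zero⟩
  linarith [hy.2]

theorem Ioo_subset_interior_integrableExpSet {L : ℝ} (hL : 0 < L) :
    Ioo (-(L / 2)) (L / 2) ⊆
      interior (ProbabilityTheory.integrableExpSet oddInt (sechMeasure L)) := by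
  refine interior_maximal (fun y hy => ?_) isOpen_Ioo
  have h := (hasSum_sechWeight_mul_exp hL (exp_mem_annulus hy)).summable
  rw [Complex.norm_real, Real.norm_of_nonneg (Real.exp_pos _).le, Real.log_exp,
    sub_add_cancel] at h
  exact integrable_sechMeasure L h

theorem mgf_sechMeasure {L : ℝ} (hL : 0 < L) {z : ℂ} (hz : z ∈ annulus (Real.exp (-L))) :
    ProbabilityTheory.mgf oddInt (sechMeasure L) (Real.log ‖z‖ + L / 2) =
      unitCircleLength * ‖z‖ * szegoDiag (annulus (Real.exp (-L))) z := by
  rw [ProbabilityTheory.mgf, integral_sechMeasure]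
  exact (hasSum_sechWeight_mul_exp hL hz).tsum_eq

theorem mgf_sechMeasure_pos {L : ℝ} (hL : 0 < L) {y : ℝ} (hy : y ∈ Ioo (-(L / 2)) (L / 2)) :
    0 < ProbabilityTheory.mgf oddInt (sechMeasure L) y :=
  ProbabilityTheory.mgf_pos' (sechMeasure_ne_zero L)
    (interior_subset (s := ProbabilityTheory.integrableExpSet oddInt (sechMeasure L))
      (Ioo_subset_interior_integrableExpSet hL hy))

theorem log_szegoDiag {L : ℝ} (hL : 0 < L) {z : ℂ} (hz : z ∈ annulus (Real.exp (-L))) :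
    Real.log (szegoDiag (annulus (Real.exp (-L))) z) =
      ProbabilityTheory.cgf oddInt (sechMeasure L) (Real.log ‖z‖ + L / 2) - Real.log ‖z‖ -
        Real.log unitCircleLength := by
  have hz0 : 0 < ‖z‖ := (Real.exp_pos _).trans hz.1
  have hc := unitCircleLength_pos
  have hp := mgf_sechMeasure_pos hL (log_norm_add_mem_Ioo hz)
  rw [ProbabilityTheory.cgf]
  rw [mgf_sechMeasure hL hz] at hp ⊢
  have hS := pos_of_mul_pos_right hp (by positivity)
  rw [Real.log_mul (by positivity) hS.ne', Real.log_mul hc.ne' hz0.ne']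
  ring

/-- The second derivative of the cumulant generating function, which is a quarter of the squared
Szegő metric of the annulus in the logarithmic coordinate. -/
noncomputable def cgfSecondDeriv (L : ℝ) : ℝ → ℝ :=
  iteratedDeriv 2 (ProbabilityTheory.cgf oddInt (sechMeasure L))

theorem analyticAt_cgfSecondDeriv {L : ℝ} (hL : 0 < L) {y : ℝ} (hy : y ∈ Ioo (-(L / 2)) (L / 2)) :
    AnalyticAt ℝ (cgfSecondDeriv L) y := by
  rw [cgfSecondDeriv, iteratedDeriv_eq_iterate]
  exact (ProbabilityTheory.analyticAt_cgf (Ioo_subset_interior_integrableExpSet hL hy)).iterated_deriv 2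

theorem hasDerivAt_cgf {L : ℝ} (hL : 0 < L) {y : ℝ} (hy : y ∈ Ioo (-(L / 2)) (L / 2)) :
    HasDerivAt (ProbabilityTheory.cgf oddInt (sechMeasure L))
      (deriv (ProbabilityTheory.cgf oddInt (sechMeasure L)) y) y :=
  (ProbabilityTheory.analyticAt_cgf
    (Ioo_subset_interior_integrableExpSet hL hy)).differentiableAt.hasDerivAt

theorem hasDerivAt_deriv_cgf {L : ℝ} (hL : 0 < L) {y : ℝ} (hy : y ∈ Ioo (-(L / 2)) (L / 2)) :
    HasDerivAt (deriv (ProbabilityTheory.cgf oddInt (sechMeasure L))) (cgfSecondDeriv L y) y := by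
  rw [cgfSecondDeriv, iteratedDeriv_succ, iteratedDeriv_one]
  exact (ProbabilityTheory.analyticAt_cgf
    (Ioo_subset_interior_integrableExpSet hL hy)).deriv.differentiableAt.hasDerivAt

/-- This is the variance of an exponentially tilted law. Every integer has positive mass, so zero
variance would force `oddInt 0 = oddInt 1`. -/
theorem cgfSecondDeriv_pos {L : ℝ} (hL : 0 < L) {y : ℝ} (hy : y ∈ Ioo (-(L / 2)) (L / 2)) :
    0 < cgfSecondDeriv L y := by
  have hi := Ioo_subset_interior_integrableExpSet hL hy
  rw [cgfSecondDeriv, ProbabilityTheory.iteratedDeriv_two_cgf_eq_integral hi]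
  refine div_pos ?_ (mgf_sechMeasure_pos hL hy)
  set m := deriv (ProbabilityTheory.cgf oddInt (sechMeasure L)) y
  have hint : Integrable (fun n => (oddInt n - m) ^ 2 * Real.exp (y * oddInt n))
      (sechMeasure L) := by
    have h0 := ProbabilityTheory.integrable_pow_mul_exp_of_mem_interior_integrableExpSet hi 0
    have h1 := ProbabilityTheory.integrable_pow_mul_exp_of_mem_interior_integrableExpSet hi 1
    have h2 := ProbabilityTheory.integrable_pow_mul_exp_of_mem_interior_integrableExpSet hi 2
    refine ((h2.sub (h1.const_mul (2 * m))).add (h0.const_mul (m ^ 2))).congr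
      (Eventually.of_forall fun n => ?_)
    simp only [Pi.add_apply, Pi.sub_apply]
    ring
  have hnn : ∀ n, 0 ≤ (oddInt n - m) ^ 2 * Real.exp (y * oddInt n) := fun n => by positivity
  refine (integral_nonneg hnn).lt_of_ne' fun h => ?_
  rw [integral_eq_zero_iff_of_nonneg hnn hint] at h
  have h' := (ae_sechMeasure_iff L).1 h
  have a := h' 0
  have b := h' 1
  simp [oddInt] at a b
  linarith

/-! ### Metric and curvature in the logarithmic coordinate -/

theorem szegoMetric_annulus {L : ℝ} (hL : 0 < L) {z : ℂ} (hz : z ∈ annulus (Real.exp (-L))) :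
    szegoMetric (annulus (Real.exp (-L))) z =
      √(cgfSecondDeriv L (Real.log ‖z‖ + L / 2)) / (2 * ‖z‖) := by
  have hz0 : 0 < ‖z‖ := (Real.exp_pos _).trans hz.1
  have hev : (fun w => Real.log (szegoDiag (annulus (Real.exp (-L))) w)) =ᶠ[𝓝 z] fun w =>
      (fun x => ProbabilityTheory.cgf oddInt (sechMeasure L) (x + L / 2) - x -
        Real.log unitCircleLength) (Real.log ‖w‖) := by
    filter_upwards [(isOpen_annulus _).mem_nhds hz] with w hw using log_szegoDiag hL hw
  have hcont : Tendsto (fun x : ℝ => x + L / 2) (𝓝 (Real.log ‖z‖)) (𝓝 (Real.log ‖z‖ + L / 2)) :=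
    (continuous_id.add continuous_const).tendsto _
  have hI := hcont.eventually (isOpen_Ioo.mem_nhds (log_norm_add_mem_Ioo hz))
  rw [szegoMetric, (laplacian_congr_nhds hev).eq_of_nhds,
    laplacian_comp_log_norm
      (h := fun x => ProbabilityTheory.cgf oddInt (sechMeasure L) (x + L / 2) - x -
        Real.log unitCircleLength)
      (h' := fun x => deriv (ProbabilityTheory.cgf oddInt (sechMeasure L))
      (x + L / 2) - 1) (h'' := cgfSecondDeriv L (Real.log ‖z‖ + L / 2)) (norm_pos_iff.1 hz0)]
  · rw [div_div, Real.sqrt_div (cgfSecondDeriv_pos hL (log_norm_add_mem_Ioo hz)).le]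
    congr 1
    rw [show ‖z‖ ^ 2 * 4 = (2 * ‖z‖) ^ 2 by ring, Real.sqrt_sq (by positivity)]
  · filter_upwards [hI] with x hx
    exact (((hasDerivAt_cgf hL hx).comp_add_const x (L / 2)).sub (hasDerivAt_id x)).sub_const _
  · exact ((hasDerivAt_deriv_cgf hL (log_norm_add_mem_Ioo hz)).comp_add_const _ (L / 2)).sub_const 1

theorem isConformalMetric_szegoMetric_annulus {L : ℝ} (hL : 0 < L) :
    IsConformalMetric (annulus (Real.exp (-L))) (szegoMetric (annulus (Real.exp (-L)))) := by
  constructor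
  · refine ContDiffOn.congr (fun z hz => ContDiffAt.contDiffWithinAt ?_)
      fun z hz => szegoMetric_annulus hL hz
    have hz0 : 0 < ‖z‖ := (Real.exp_pos _).trans hz.1
    have hnorm : ContDiffAt ℝ 2 (fun z : ℂ => ‖z‖) z := contDiffAt_norm ℝ (norm_pos_iff.1 hz0)
    have hy := log_norm_add_mem_Ioo hz
    refine ContDiffAt.div (ContDiffAt.sqrt ?_ (cgfSecondDeriv_pos hL hy).ne')
      (contDiffAt_const.mul hnorm) (by positivity)
    exact ContDiffAt.comp z (analyticAt_cgfSecondDeriv hL hy).contDiffAt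
      ((hnorm.log hz0.ne').add contDiffAt_const)
  · intro z hz
    have hz0 : 0 < ‖z‖ := (Real.exp_pos _).trans hz.1
    rw [szegoMetric_annulus hL hz]
    have := Real.sqrt_pos.2 (cgfSecondDeriv_pos hL (log_norm_add_mem_Ioo hz))
    positivity

/-- In the logarithmic coordinate `log s` is `(log K'') / 2` plus an affine term, where `K''` is
`cgfSecondDeriv L`. The factors `|z|²` cancel, leaving `-2 (log K'')'' / K''`. -/
theorem gaussianCurvature_szegoMetric_annulus {L : ℝ} (hL : 0 < L) {z : ℂ}
    (hz : z ∈ annulus (Real.exp (-L))) {D : ℝ → ℝ} {D' : ℝ}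
    (h1 : ∀ᶠ y in 𝓝 (Real.log ‖z‖ + L / 2), HasDerivAt (cgfSecondDeriv L) (D y) y)
    (h2 : HasDerivAt D D' (Real.log ‖z‖ + L / 2)) :
    gaussianCurvature (szegoMetric (annulus (Real.exp (-L)))) z =
      -2 * (D' * cgfSecondDeriv L (Real.log ‖z‖ + L / 2) - D (Real.log ‖z‖ + L / 2) ^ 2) /
        cgfSecondDeriv L (Real.log ‖z‖ + L / 2) ^ 3 := by
  have hz0 : 0 < ‖z‖ := (Real.exp_pos _).trans hz.1
  have hy := log_norm_add_mem_Ioo hz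
  have hH := cgfSecondDeriv_pos hL hy
  have hev : (fun w => Real.log (szegoMetric (annulus (Real.exp (-L))) w)) =ᶠ[𝓝 z] fun w =>
      (fun x => Real.log (cgfSecondDeriv L (x + L / 2)) / 2 - x - Real.log 2)
        (Real.log ‖w‖) := by
    filter_upwards [(isOpen_annulus _).mem_nhds hz] with w hw
    have hw0 : 0 < ‖w‖ := (Real.exp_pos _).trans hw.1
    have hHw := cgfSecondDeriv_pos hL (log_norm_add_mem_Ioo hw)
    rw [szegoMetric_annulus hL hw, Real.log_div (Real.sqrt_pos.2 hHw).ne' (by positivity),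
      Real.log_sqrt hHw.le, Real.log_mul two_ne_zero hw0.ne']
    ring
  have hcont : Tendsto (fun x : ℝ => x + L / 2) (𝓝 (Real.log ‖z‖)) (𝓝 (Real.log ‖z‖ + L / 2)) :=
    (continuous_id.add continuous_const).tendsto _
  have hI := hcont.eventually (isOpen_Ioo.mem_nhds hy)
  rw [gaussianCurvature, (laplacian_congr_nhds hev).eq_of_nhds,
    laplacian_comp_log_norm
      (h := fun x => Real.log (cgfSecondDeriv L (x + L / 2)) / 2 - x - Real.log 2)
      (h' := fun x => D (x + L / 2) / cgfSecondDeriv L (x + L / 2) / 2 - 1)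
      (norm_pos_iff.1 hz0) ?_
      ((((h2.comp_add_const _ (L / 2)).div (h1.self_of_nhds.comp_add_const _ (L / 2))
        hH.ne').div_const 2).sub_const 1),
    szegoMetric_annulus hL hz, div_pow, Real.sq_sqrt hH.le]
  · field_simp
  · filter_upwards [hI, hcont.eventually h1] with x hx hx1
    exact ((((hx1.comp_add_const x (L / 2)).log (cgfSecondDeriv_pos hL hx).ne').div_const 2).sub
      (hasDerivAt_id x)).sub_const _

/-! ### Moments and the middle circle -/

/-- The exponentially tilted moments of the odd integers with respect to `sechMeasure L`. -/
noncomputable def tiltedMoment (L : ℝ) (j : ℕ) (y : ℝ) : ℝ :=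
  ∫ n, oddInt n ^ j * Real.exp (y * oddInt n) ∂sechMeasure L

theorem hasDerivAt_tiltedMoment {L : ℝ} (hL : 0 < L) {y : ℝ} (hy : y ∈ Ioo (-(L / 2)) (L / 2))
    (j : ℕ) : HasDerivAt (tiltedMoment L j) (tiltedMoment L (j + 1) y) y :=
  ProbabilityTheory.hasDerivAt_integral_pow_mul_exp_real
    (Ioo_subset_interior_integrableExpSet hL hy) j

theorem tiltedMoment_zero_eq_mgf (L : ℝ) (y : ℝ) :
    tiltedMoment L 0 y = ProbabilityTheory.mgf oddInt (sechMeasure L) y := by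
  simp [tiltedMoment, ProbabilityTheory.mgf]

theorem cgfSecondDeriv_eq {L : ℝ} (hL : 0 < L) {y : ℝ} (hy : y ∈ Ioo (-(L / 2)) (L / 2)) :
    cgfSecondDeriv L y = tiltedMoment L 2 y / tiltedMoment L 0 y -
      (tiltedMoment L 1 y / tiltedMoment L 0 y) ^ 2 := by
  have hi := Ioo_subset_interior_integrableExpSet hL hy
  rw [cgfSecondDeriv, ProbabilityTheory.iteratedDeriv_two_cgf hi, ProbabilityTheory.deriv_cgf hi,
    tiltedMoment_zero_eq_mgf]
  simp [tiltedMoment]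

theorem tiltedMoment_zero_right (L : ℝ) (j : ℕ) :
    tiltedMoment L j 0 = ∑' n, sechWeight L n * oddInt n ^ j := by
  rw [tiltedMoment, integral_sechMeasure]
  simp

theorem oddInt_neg_one_sub (n : ℤ) : oddInt (-1 - n) = -oddInt n := by
  simp only [oddInt]
  push_cast
  ring

/-- The reflection `n ↦ -1 - n` negates the odd integers and preserves the weights. -/
theorem tiltedMoment_zero_right_of_odd (L : ℝ) {j : ℕ} (hj : Odd j) : tiltedMoment L j 0 = 0 := by
  rw [tiltedMoment_zero_right]
  have h := (Equiv.subLeft (-1 : ℤ)).tsum_eq fun n => sechWeight L n * oddInt n ^ j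
  simp only [Equiv.subLeft_apply, sechWeight, oddInt_neg_one_sub, hj.neg_pow, neg_mul,
    Real.cosh_neg, mul_neg, tsum_neg] at h
  simp only [sechWeight]
  linarith

/-- The curvature of the Szegő metric of the annulus on its middle circle. -/
theorem gaussianCurvature_middle {L : ℝ} (hL : 0 < L) :
    gaussianCurvature (szegoMetric (annulus (Real.exp (-L)))) (Real.exp (0 - L / 2) : ℂ) =
      6 - 2 * (tiltedMoment L 4 0 * tiltedMoment L 0 0 / tiltedMoment L 2 0 ^ 2) := by
  have h0 : (0 : ℝ) ∈ Ioo (-(L / 2)) (L / 2) := ⟨by linarith, by linarith⟩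
  have hz := exp_mem_annulus h0
  have hlog : Real.log ‖(Real.exp (0 - L / 2) : ℂ)‖ + L / 2 = 0 := by
    rw [Complex.norm_real, Real.norm_of_nonneg (Real.exp_pos _).le, Real.log_exp]
    ring
  have hm0 : ∀ y ∈ Ioo (-(L / 2)) (L / 2), tiltedMoment L 0 y ≠ 0 := fun y hy => by
    rw [tiltedMoment_zero_eq_mgf]
    exact (mgf_sechMeasure_pos hL hy).ne'
  have hd := fun (j : ℕ) (y : ℝ) (hy : y ∈ Ioo (-(L / 2)) (L / 2)) =>
    hasDerivAt_tiltedMoment hL hy j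
  have hD : ∀ y ∈ Ioo (-(L / 2)) (L / 2), HasDerivAt (cgfSecondDeriv L)
      ((tiltedMoment L 3 y * tiltedMoment L 0 y - tiltedMoment L 2 y * tiltedMoment L 1 y) /
        tiltedMoment L 0 y ^ 2 - 2 * (tiltedMoment L 1 y / tiltedMoment L 0 y) *
        ((tiltedMoment L 2 y * tiltedMoment L 0 y - tiltedMoment L 1 y * tiltedMoment L 1 y) /
          tiltedMoment L 0 y ^ 2)) y := by
    intro y hy
    have h := ((hd 2 y hy).div (hd 0 y hy) (hm0 y hy)).sub
      (((hd 1 y hy).div (hd 0 y hy) (hm0 y hy)).pow 2)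
    refine (h.congr_of_eventuallyEq ?_).congr_deriv ?_
    · filter_upwards [isOpen_Ioo.mem_nhds hy] with t ht using cgfSecondDeriv_eq hL ht
    · simp
  have hne := hm0 0 h0
  have hD' := ((((hd 3 0 h0).mul (hd 0 0 h0)).sub ((hd 2 0 h0).mul (hd 1 0 h0))).div
      ((hd 0 0 h0).pow 2) (pow_ne_zero 2 hne)).sub
    ((((hd 1 0 h0).div (hd 0 0 h0) hne).const_mul 2).mul
      ((((hd 2 0 h0).mul (hd 0 0 h0)).sub ((hd 1 0 h0).mul (hd 1 0 h0))).div
        ((hd 0 0 h0).pow 2) (pow_ne_zero 2 hne)))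
  have hH := cgfSecondDeriv_eq hL h0
  have hpos := cgfSecondDeriv_pos hL h0
  have k1 : tiltedMoment L 1 0 = 0 := tiltedMoment_zero_right_of_odd L (by decide)
  have k3 : tiltedMoment L 3 0 = 0 := tiltedMoment_zero_right_of_odd L (by decide)
  -- As the first moment vanishes, a zero second moment would contradict the positive variance.
  have hne2 : tiltedMoment L 2 0 ≠ 0 := fun h => hpos.ne' (by rw [hH, h, k1]; simp)
  have hg := gaussianCurvature_szegoMetric_annulus hL hz
    (D := fun y => (tiltedMoment L 3 y * tiltedMoment L 0 y -
        tiltedMoment L 2 y * tiltedMoment L 1 y) /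
        tiltedMoment L 0 y ^ 2 - 2 * (tiltedMoment L 1 y / tiltedMoment L 0 y) *
        ((tiltedMoment L 2 y * tiltedMoment L 0 y - tiltedMoment L 1 y * tiltedMoment L 1 y) /
          tiltedMoment L 0 y ^ 2))
    (by
      rw [hlog]
      filter_upwards [isOpen_Ioo.mem_nhds h0] with y hy using hD y hy)
    (by
      rw [hlog]
      exact hD')
  rw [hg, hlog, hH]
  simp [k1, k3]
  field_simp
  ring

/-! ### The limit of thin inner holes -/

theorem one_le_abs_oddInt (n : ℤ) : 1 ≤ |oddInt n| := by
  have h : (1 : ℤ) ≤ |2 * n + 1| := Int.one_le_abs (by omega)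
  have e : |oddInt n| = ((|2 * n + 1| : ℤ) : ℝ) := by
    rw [oddInt]
    push_cast
    rfl
  rw [e]
  exact_mod_cast h

theorem cosh_mul_sechWeight_le {L : ℝ} (hL : 0 ≤ L) (n : ℤ) :
    2 * Real.cosh (L / 2) * sechWeight L n ≤ 2 * Real.exp (-((|oddInt n| - 1) * (L / 2))) := by
  have h1 : Real.cosh (L / 2) ≤ Real.exp (L / 2) := by
    rw [Real.cosh_eq]
    have : Real.exp (-(L / 2)) ≤ Real.exp (L / 2) := Real.exp_le_exp.2 (by linarith)
    linarith
  have h2 : Real.exp (|oddInt n| * (L / 2)) ≤ 2 * Real.cosh (oddInt n * (L / 2)) := by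
    rw [← Real.cosh_abs, abs_mul, abs_of_nonneg (by linarith : 0 ≤ L / 2), Real.cosh_eq]
    have := Real.exp_pos (-(|oddInt n| * (L / 2)))
    linarith
  have h3 : -((|oddInt n| - 1) * (L / 2)) = L / 2 - |oddInt n| * (L / 2) := by ring
  rw [h3, Real.exp_sub, sechWeight, ← div_eq_mul_inv, mul_div_assoc]
  gcongr

theorem summable_abs_oddInt_pow_mul_exp (j : ℕ) :
    Summable fun n => |oddInt n| ^ j * Real.exp (-|oddInt n|) := by
  have h : Summable fun n : ℕ => ((2 * n + 1 : ℕ) : ℝ) ^ j * Real.exp (-((2 * n + 1 : ℕ) : ℝ)) := by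
    have := (Real.summable_pow_mul_exp_neg_nat_mul j one_pos).comp_injective
      (i := fun n : ℕ => 2 * n + 1) (fun a b hab => by simpa using hab)
    refine this.congr fun n => ?_
    simp
  refine Summable.of_nat_of_neg_add_one (h.congr fun n => ?_) (h.congr fun n => ?_)
  · have : |oddInt n| = ((2 * n + 1 : ℕ) : ℝ) := by
      rw [oddInt, abs_of_nonneg (by positivity)]
      push_cast
      ring
    rw [this]
  · have : |oddInt (-(n + 1))| = ((2 * n + 1 : ℕ) : ℝ) := by
      have e : oddInt (-(n + 1)) = -(2 * n + 1) := by
        simp only [oddInt]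
        push_cast
        ring
      rw [e, abs_neg, abs_of_nonneg (by positivity)]
      push_cast
      ring
    rw [this]

/-- The indices `0` and `-1` are the odd integers `±1`, whose rescaled weight is exactly `1` for
every `L`; all others decay exponentially. -/
theorem tendsto_cosh_mul_sechWeight (n : ℤ) :
    Tendsto (fun L => 2 * Real.cosh (L / 2) * sechWeight L n) atTop
      (𝓝 (if n ∈ ({0, -1} : Finset ℤ) then 1 else 0)) := by
  split_ifs with hn
  · refine tendsto_const_nhds.congr fun L => ?_
    have := Real.cosh_pos (L / 2)
    have hn' : oddInt n = 1 ∨ oddInt n = -1 := by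
      simp only [Finset.mem_insert, Finset.mem_singleton] at hn
      rcases hn with rfl | rfl
      · left; simp [oddInt]
      · right; norm_num [oddInt]
    rcases hn' with h | h <;> rw [sechWeight, h] <;> simp <;> field_simp
  · have h3 : 1 < |oddInt n| := by
      refine lt_of_le_of_ne (one_le_abs_oddInt n) fun h => hn ?_
      simp only [Finset.mem_insert, Finset.mem_singleton]
      rcases eq_or_eq_neg_of_abs_eq h.symm with h | h
      · left
        rw [oddInt] at h
        exact_mod_cast (by linarith : (n : ℝ) = 0)
      · right
        rw [oddInt] at h
        exact_mod_cast (by linarith : (n : ℝ) = -1)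
    refine squeeze_zero' (g := fun L => 2 * Real.exp (-((|oddInt n| - 1) * (L / 2))))
      (Eventually.of_forall fun L => ?_) ?_ ?_
    · have := Real.cosh_pos (L / 2)
      have := sechWeight_pos L n
      positivity
    · filter_upwards [eventually_ge_atTop 0] with L hL using cosh_mul_sechWeight_le hL n
    · have h4 : Tendsto (fun L : ℝ => (|oddInt n| - 1) * (L / 2)) atTop atTop :=
        (tendsto_id.atTop_div_const two_pos).const_mul_atTop (by linarith)
      simpa using (Real.tendsto_exp_neg_atTop_nhds_zero.comp h4).const_mul 2

theorem tendsto_cosh_mul_tiltedMoment {j : ℕ} (hj : Even j) :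
    Tendsto (fun L => 2 * Real.cosh (L / 2) * tiltedMoment L j 0) atTop (𝓝 2) := by
  have h : Tendsto (fun L => ∑' n, 2 * Real.cosh (L / 2) * sechWeight L n * oddInt n ^ j) atTop
      (𝓝 (∑' n : ℤ, (if n ∈ ({0, -1} : Finset ℤ) then 1 else 0) * oddInt n ^ j)) := by
    refine tendsto_tsum_of_dominated_convergence
      ((summable_abs_oddInt_pow_mul_exp j).mul_left (2 * Real.exp 1))
      (fun n => (tendsto_cosh_mul_sechWeight n).mul_const _) ?_
    -- For `L ≥ 2` the decay rate `L/2` is at least `1`, which makes the dominating series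
    -- independent of `L`.
    filter_upwards [eventually_ge_atTop 2] with L hL n
    have h1 := Real.cosh_pos (L / 2)
    have h2 := sechWeight_pos L n
    rw [norm_mul, Real.norm_of_nonneg (by positivity), norm_pow, Real.norm_eq_abs]
    have h3 : 2 * Real.cosh (L / 2) * sechWeight L n ≤
        2 * (Real.exp 1 * Real.exp (-|oddInt n|)) := by
      refine (cosh_mul_sechWeight_le (by linarith) n).trans ?_
      rw [← Real.exp_add]
      have := one_le_abs_oddInt n
      have : Real.exp (-((|oddInt n| - 1) * (L / 2))) ≤ Real.exp (1 + -|oddInt n|) :=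
        Real.exp_le_exp.2 (by nlinarith)
      linarith
    calc _ ≤ 2 * (Real.exp 1 * Real.exp (-|oddInt n|)) * |oddInt n| ^ j := by gcongr
      _ = _ := by ring
  have e : ∑' n : ℤ, (if n ∈ ({0, -1} : Finset ℤ) then (1 : ℝ) else 0) * oddInt n ^ j = 2 := by
    rw [tsum_eq_sum (s := ({0, -1} : Finset ℤ)) fun n hn => by rw [if_neg hn, zero_mul],
      Finset.sum_pair (by decide)]
    have : oddInt (-1) = -1 := by norm_num [oddInt]
    rw [this, hj.neg_one_pow]
    norm_num [oddInt]
  rw [e] at h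
  refine h.congr fun L => ?_
  rw [tiltedMoment_zero_right, ← tsum_mul_left]
  congr with n
  ring

theorem tendsto_gaussianCurvature_middle :
    Tendsto (fun L => gaussianCurvature (szegoMetric (annulus (Real.exp (-L))))
      (Real.exp (0 - L / 2) : ℂ)) atTop (𝓝 4) := by
  have h := (((tendsto_cosh_mul_tiltedMoment (j := 4) (by decide)).mul
    (tendsto_cosh_mul_tiltedMoment (j := 0) (by decide))).div
    ((tendsto_cosh_mul_tiltedMoment (j := 2) (by decide)).pow 2) (by norm_num)).const_mul 2
  have h' := (tendsto_const_nhds (x := (6 : ℝ))).sub h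
  norm_num at h'
  refine h'.congr' ?_
  filter_upwards [eventually_gt_atTop 0] with L hL
  have := (Real.cosh_pos (L / 2)).ne'
  -- The moment ratio is homogeneous of degree `0`, so the rescaling by `2 cosh (L/2)` cancels.
  rw [gaussianCurvature_middle hL, mul_mul_mul_comm, mul_pow, ← sq, mul_div_mul_left _ _
    (by positivity)]

end Szego

theorem mainTheorem7 :
    (∀ ε : ℝ, 0 < ε → ∃ Ω : Set ℂ, Szego.IsSmoothlyBoundedDomain Ω ∧
      Szego.IsSzegoKernel Ω (Szego.szegoKernel Ω) ∧
      Szego.IsConformalMetric Ω (Szego.szegoMetric Ω) ∧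
      ∃ z ∈ Ω, 4 - ε < Szego.gaussianCurvature (Szego.szegoMetric Ω) z) ∧
    (∀ C : ℝ, (∀ Ω : Set ℂ, Szego.IsSmoothlyBoundedDomain Ω → ∀ z ∈ Ω,
      Szego.gaussianCurvature (Szego.szegoMetric Ω) z ≤ C) → 4 ≤ C) := by
  have main : ∀ ε : ℝ, 0 < ε → ∃ Ω : Set ℂ, Szego.IsSmoothlyBoundedDomain Ω ∧
      Szego.IsSzegoKernel Ω (Szego.szegoKernel Ω) ∧
      Szego.IsConformalMetric Ω (Szego.szegoMetric Ω) ∧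
      ∃ z ∈ Ω, 4 - ε < Szego.gaussianCurvature (Szego.szegoMetric Ω) z := by
    intro ε hε
    obtain ⟨L, hLε, hL⟩ := ((Szego.tendsto_gaussianCurvature_middle.eventually
      (lt_mem_nhds (by linarith : 4 - ε < 4))).and (eventually_gt_atTop 0)).exists
    have h1 : Real.exp (-L) < 1 := by simpa using hL
    exact ⟨Szego.annulus (Real.exp (-L)),
      Szego.isSmoothlyBoundedDomain_annulus (Real.exp_pos _) h1,
      Szego.isSzegoKernel_szegoKernel_annulus (Real.exp_pos _) h1,
      Szego.isConformalMetric_szegoMetric_annulus hL, _,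
      Szego.exp_mem_annulus ⟨by linarith, by linarith⟩, hLε⟩
  refine ⟨main, fun C hC => le_of_forall_pos_lt_add fun ε hε => ?_⟩
  obtain ⟨Ω, hΩ, -, -, z, hz, h⟩ := main ε hε
  linarith [hC Ω hΩ z hz]
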